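/- \textbf{Model.} Distinct points $x_0, x_1, x_2, \dots$ of a metric space $(X,d)$ arrive one by one; when $x_i$ arrives, the distances $d(x_i,x_j)$, $j<i$, are revealed. An online algorithm maintains a spanning tree $T_n$ on the points $x_0,\dots,x_n$ that have arrived so far. Upon the arrival of $x_i$ ($i\ge 1$) it adds one edge that connects $x_i$ to an earlier point, and then performs some number $s_i\ge 0$ of swaps; a swap replaces the current tree $T$ by a tree $T+f-e$, where $e$ is an edge of $T$ and $f$ is an edge between two arrived points that is not in $T$. All decisions upon the arrival of $x_i$ depend only on the distances between $x_0,\dots,x_i$. The cost of a tree is the sum of the lengths of its edges, and $\mathrm{Opt}_n$ denotes the infimum of the costs of all Steiner trees for $x_0,\dots,x_n$, i.e. of all trees on a finite set of points of $X$ that contains $x_0,\dots,x_n$. \textbf{Theorem.} There is an absolute constant $c>0$ such that for every $\delta$ with $0<\delta\le 1$ there is a (deterministic) online algorithm with the following properties, for every metric space, every sequence of distinct points in it, and every $n\ge 0$ such that $x_0,\dots,x_n$ have arrived: \begin{enumerate} \item it is $2^{O(1/\delta)}$-competitive: $T_n$ is a spanning tree on $x_0,\dots,x_n$ and $\mathrm{cost}(T_n)\le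 2^{c/\delta}\cdot \mathrm{Opt}_n$; \item it performs at most one swap per arrival: $s_i\le 1$ for all $1\le i\le n$; \item it performs at most $\delta$ swaps per arrival in the amortized sense: $\sum_{i=1}^n s_i\le \delta n$. \end{enumerate} -/

import Mathlib

namespace OnlineSteiner

/-- The cost of a finite graph whose vertices `v` are located at the points `p v` of a metric
space: the sum over the edges `{u, v}` of the distances `dist (p u) (p v)`. -/
noncomputable def cost {X V : Type*} [MetricSpace X] [Fintype V] (p : V → X)
    (G : SimpleGraph V) : ℝ :=
  open Classical in
  ∑ e ∈ G.edgeFinset,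
    Sym2.lift ⟨fun u v => dist (p u) (p v), fun u v => dist_comm (p u) (p v)⟩ e

/-- `Opt([n])`: the cost of an optimal Steiner tree on the terminals `x 0, …, x n`, i.e. the
infimum of the costs of all trees on a finite set `V` of points of the metric space `X`
that contains all the terminals (and possibly other points of `X`). -/
noncomputable def steinerOpt {X : Type*} [MetricSpace X] (x : ℕ → X) (n : ℕ) : ℝ :=
  sInf {c : ℝ | ∃ (V : Finset X) (G : SimpleGraph V),
    (∀ i ≤ n, x i ∈ V) ∧ G.IsTree ∧ c = cost (fun v : V => (v : X)) G}

/-- What an online algorithm does when vertex `n + 1` arrives: it connects the new vertex to an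
earlier vertex `parent`, and then performs a list of edge swaps; the entry `(e, f)` stands for
removing the edge `e` and adding the edge `f`. -/
structure Action (n : ℕ) where
  parent : Fin (n + 1)
  swaps : List (Sym2 (Fin (n + 2)) × Sym2 (Fin (n + 2)))

/-- An online algorithm: its action upon the arrival of vertex `n + 1` is a function of the
pairwise distances between the vertices `0, …, n + 1` only. -/
structure OnlineAlgorithm where
  act : ∀ n : ℕ, (Fin (n + 2) → Fin (n + 2) → ℝ) → Action n

/-- The graph `T + f - e`. -/
def swapEdge {V : Type*} (T : SimpleGraph V) (s : Sym2 V × Sym2 V) : SimpleGraph V :=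
  SimpleGraph.fromEdgeSet (insert s.2 (T.edgeSet \ {s.1}))

/-- The result of performing a list of swaps one after the other. -/
def applySwaps {V : Type*} (T : SimpleGraph V) (l : List (Sym2 V × Sym2 V)) : SimpleGraph V :=
  l.foldl swapEdge T

/-- All swaps of the list are legal: each of them, applied to the tree reached so far, exchanges
an edge of that tree for an edge outside it and yields a spanning tree again. -/
def ValidSwaps {V : Type*} : SimpleGraph V → List (Sym2 V × Sym2 V) → Prop
  | _, [] => True
  | T, s :: l => s.1 ∈ T.edgeSet ∧ s.2 ∉ T.edgeSet ∧ (swapEdge T s).IsTree ∧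
      ValidSwaps (swapEdge T s) l

/-- The graph `T` on `{0, …, n}`, together with the new vertex `n + 1` and the single new edge
that connects it to `p`. -/
def attach {n : ℕ} (T : SimpleGraph (Fin (n + 1))) (p : Fin (n + 1)) :
    SimpleGraph (Fin (n + 2)) :=
  T.map Fin.castSucc ⊔ SimpleGraph.edge p.castSucc (Fin.last (n + 1))

namespace OnlineAlgorithm

/-- The action of the algorithm upon the arrival of `x (n + 1)`, on the request sequence `x`. -/
def action {X : Type*} [MetricSpace X] (A : OnlineAlgorithm) (x : ℕ → X) (n : ℕ) : Action n :=
  A.act n fun i j => dist (x i) (x j)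

/-- The graph `T_n` on `{0, …, n}` that the algorithm maintains after the arrivals of
`x 1, …, x n`; initially there is only the root vertex `0`. -/
def tree {X : Type*} [MetricSpace X] (A : OnlineAlgorithm) (x : ℕ → X) :
    (n : ℕ) → SimpleGraph (Fin (n + 1))
  | 0 => ⊥
  | n + 1 => applySwaps (attach (A.tree x n) (A.action x n).parent) (A.action x n).swaps

/-- The number of swaps performed upon the arrival of `x (n + 1)`. -/
def numSwaps {X : Type*} [MetricSpace X] (A : OnlineAlgorithm) (x : ℕ → X) (n : ℕ) : ℕ :=
  (A.action x n).swaps.length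

end OnlineAlgorithm

end OnlineSteiner

namespace OnlineSteiner

open Finset MeasureTheory
open scoped ENNReal

/-! ### Connectivity, component counts and edge exchange in trees. -/

section Graphs

variable {V κ : Type*}

/-! The algorithm joins each new point to its nearest neighbour and then, if possible, performs one
swap that shortens an edge by a factor of at least `K = 2 ^ (6 / δ)`, choosing a removable edge of
maximal length.

Number of swaps: the sum of the logarithms of the edge lengths grows by the logarithm of the greedy
connection length at an arrival and drops by at least `log K` at a swap. Growing disjoint balls
around the greedy points and integrating over all radii shows that the greedy lengths exceed those
of any later spanning tree, in this logarithmic sense, by at most 2 per edge (`exists_packing`,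
`sum_logExcess_add_le`). Hence the number of swaps times `log K` is at most `2 * n`.

Cost: fix a level `L` and call a time calm if, just before its swap, no pending swap removes an edge
of length at least `L`. At a calm time the number of edges of length at least `r`, for `r ≥ L`, is
less than the number of components at distance threshold `r / K`. At every time after the last calm
time `t` an edge of length at least `L` is swapped out, which costs a truncated logarithmic
potential `log K`. The packing bound, started from a minimum spanning tree at time `t`, limits the
number of these steps. So the number of edges of length at least `L` is at most `4 * A + 2 * N`,
where `A` and `N` are the component counts minus one at threshold `L / K`, at time `t` and now
(`card_longEdges_tree_le`).

It remains to integrate over `L`. A Steiner tree pays for component counts by growing moats around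
the terminals. The last calm time depends on `L` but increases with it, so the set of active
terminals only grows with the radius, and each Steiner edge is still charged on an interval no
longer than itself (`label_ne_subset_Icc`, `exists_moats`). This gives cost at most `18 * K` times
the optimum. -/

theorem rel_of_reachable {G : SimpleGraph V} {R : V → V → Prop} (hr : ∀ u, R u u)
    (ht : ∀ u v w, R u v → R v w → R u w) (h : ∀ u v, G.Adj u v → R u v) {u v : V}
    (huv : G.Reachable u v) : R u v := by
  obtain ⟨p⟩ := huv
  induction p with
  | nil => exact hr _
  | cons hadj _ ih => exact ht _ _ _ (h _ _ hadj) ih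

theorem reachable_map {G : SimpleGraph V} (f : V → κ) {u v : V} (h : G.Reachable u v) :
    (G.map f).Reachable (f u) (f v) := by
  refine rel_of_reachable (R := fun u v => (G.map f).Reachable (f u) (f v))
    (fun _ => .refl _) (fun _ _ _ h1 h2 => h1.trans h2) (fun u v huv => ?_) h
  by_cases hne : f u = f v
  · exact hne ▸ SimpleGraph.Reachable.refl _
  · exact (SimpleGraph.map_adj_apply' huv hne).reachable

theorem connected_map {G : SimpleGraph V} (hG : G.Connected) {f : V → κ}
    (hf : Function.Surjective f) : (G.map f).Connected := by
  have := hG.nonempty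
  refine @SimpleGraph.Connected.mk _ _ (fun a b => ?_) (this.map f)
  obtain ⟨u, rfl⟩ := hf a
  obtain ⟨v, rfl⟩ := hf b
  exact reachable_map f (hG.preconnected u v)

/-- The finite set of edges of a graph on a finite vertex set. -/
noncomputable def edges [Finite V] (G : SimpleGraph V) : Finset (Sym2 V) :=
  G.edgeSet.toFinite.toFinset

@[simp] theorem mem_edges [Finite V] {G : SimpleGraph V} {e : Sym2 V} :
    e ∈ edges G ↔ e ∈ G.edgeSet := by simp [edges]

theorem card_edges [Finite V] (G : SimpleGraph V) : (edges G).card = Nat.card G.edgeSet := by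
  rw [edges, ← Set.ncard_eq_toFinset_card, Nat.card_coe_set_eq]

theorem isTree_card_edges [Finite V] {T : SimpleGraph V} (hT : T.IsTree) :
    (edges T).card + 1 = Nat.card V := by
  rw [card_edges]
  exact (SimpleGraph.isTree_iff_connected_and_card.1 hT).2

theorem isTree_of_connected_card [Finite V] {T : SimpleGraph V} (hT : T.Connected)
    (h : (edges T).card + 1 = Nat.card V) : T.IsTree := by
  rw [card_edges] at h
  exact SimpleGraph.isTree_iff_connected_and_card.2 ⟨hT, h⟩

/-- A function on the vertices of a connected graph takes at most one value more than there are
edges along which it changes. -/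
theorem ncard_range_le [Finite V] {G : SimpleGraph V} (hG : G.Connected) (f : V → κ)
    (S : Finset (Sym2 V)) (hS : ∀ u v, G.Adj u v → f u ≠ f v → s(u, v) ∈ S) :
    (Set.range f).ncard ≤ S.card + 1 := by
  classical
  -- The image of `G` on the range of `f` is connected, and each of its edges comes from an edge of
  -- `G` along which `f` changes.
  have hc := connected_map hG (Set.rangeFactorization_surjective (f := f))
  set Γ := G.map (Set.rangeFactorization f) with hΓ
  have h1 := hc.card_vert_le_card_edgeSet_add_one
  have h2 : Nat.card Γ.edgeSet ≤ S.card := by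
    have h3 : Γ.edgeSet ⊆ (S.image (Sym2.map (Set.rangeFactorization f)) : Finset _) := by
      intro e he
      induction e with | h a b => ?_
      rw [SimpleGraph.mem_edgeSet, hΓ, SimpleGraph.map_adj'] at he
      obtain ⟨hab, u, v, huv, rfl, rfl⟩ := he
      rw [Finset.mem_coe, Finset.mem_image]
      refine ⟨s(u, v), hS u v huv (fun h => hab (Subtype.ext h)), rfl⟩
    rw [Nat.card_coe_set_eq]
    refine (Set.ncard_le_ncard h3 (Finset.finite_toSet _)).trans ?_
    rw [Set.ncard_coe_finset]
    exact Finset.card_image_le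
  rw [Nat.card_coe_set_eq] at h1
  omega

/-- The number of connected components. -/
noncomputable def cc (G : SimpleGraph V) : ℕ := Nat.card G.ConnectedComponent

theorem one_le_cc [Finite V] [Nonempty V] (G : SimpleGraph V) : 1 ≤ cc G := by
  have : Finite G.ConnectedComponent := Quot.finite _
  have : Nonempty G.ConnectedComponent := ‹Nonempty V›.map G.connectedComponentMk
  exact Nat.card_pos

theorem cc_le_of_adj_reachable [Finite V] {G H : SimpleGraph V}
    (h : ∀ u v, H.Adj u v → G.Reachable u v) : cc G ≤ cc H := by
  have : Finite H.ConnectedComponent := Quot.finite _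
  refine Nat.card_le_card_of_surjective
    (SimpleGraph.ConnectedComponent.lift (fun v => G.connectedComponentMk v) ?_) ?_
  · intro u v p _
    rw [SimpleGraph.ConnectedComponent.eq]
    exact rel_of_reachable (R := G.Reachable) (fun _ => .refl _) (fun _ _ _ h1 h2 => h1.trans h2)
      h ⟨p⟩
  · intro c
    induction c using SimpleGraph.ConnectedComponent.ind with | h v => ?_
    exact ⟨H.connectedComponentMk v, rfl⟩

theorem cc_le_card_add_one [Finite V] {G H : SimpleGraph V} (hG : G.Connected)
    (S : Finset (Sym2 V)) (hS : ∀ u v, G.Adj u v → ¬ H.Adj u v → s(u, v) ∈ S) :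
    cc H ≤ S.card + 1 := by
  have h := ncard_range_le hG H.connectedComponentMk S (fun u v huv hne => hS u v huv
    (fun hadj => hne (SimpleGraph.ConnectedComponent.eq.2 hadj.reachable)))
  have h2 : Set.range H.connectedComponentMk = Set.univ := Set.eq_univ_of_forall fun c => by
    induction c using SimpleGraph.ConnectedComponent.ind with | h v => ?_
    exact ⟨v, rfl⟩
  rwa [h2, Set.ncard_univ] at h

/-- A star on one representative per component makes `H` connected at the price of at most `cc H -
1` further edges. -/
theorem card_le_edges_add_cc [Finite V] [Nonempty V] (H : SimpleGraph V) :
    Nat.card V ≤ (edges H).card + cc H := by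
  classical
  have : Finite H.ConnectedComponent := Quot.finite _
  have : Fintype H.ConnectedComponent := Fintype.ofFinite _
  let c0 : H.ConnectedComponent := H.connectedComponentMk (Classical.arbitrary V)
  let R : Finset (Sym2 V) := (Finset.univ.erase c0).image fun c => s(c0.out, c.out)
  let G : SimpleGraph V := H ⊔ SimpleGraph.fromEdgeSet R
  have hout : ∀ v, H.Reachable (H.connectedComponentMk v).out v := fun v =>
    SimpleGraph.ConnectedComponent.eq.1 (Quot.out_eq (H.connectedComponentMk v))
  have hroot : ∀ v, G.Reachable c0.out v := by
    intro v
    refine SimpleGraph.Reachable.trans (v := (H.connectedComponentMk v).out) ?_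
      ((hout v).mono le_sup_left)
    by_cases hv : H.connectedComponentMk v = c0
    · rw [hv]
    · refine SimpleGraph.Adj.reachable (Or.inr ?_)
      rw [SimpleGraph.fromEdgeSet_adj]
      refine ⟨Finset.mem_coe.2 (Finset.mem_image.2 ⟨_, Finset.mem_erase.2 ⟨hv, mem_univ _⟩, rfl⟩),
        fun h => hv ?_⟩
      have := congrArg H.connectedComponentMk h
      rw [show H.connectedComponentMk c0.out = c0 from Quot.out_eq c0,
        show H.connectedComponentMk (H.connectedComponentMk v).out = H.connectedComponentMk v
          from Quot.out_eq _] at this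
      exact this.symm
  have hG : G.Connected := (SimpleGraph.connected_iff _).2
    ⟨fun u v => (hroot u).symm.trans (hroot v), inferInstance⟩
  have h := ncard_range_le hG (id : V → V) (edges H ∪ R) (by
    rintro u v (huv | huv) -
    · exact Finset.mem_union_left _ (mem_edges.2 huv)
    · exact Finset.mem_union_right _ ((SimpleGraph.fromEdgeSet_adj _).1 huv).1)
  rw [Set.range_id, Set.ncard_univ] at h
  have h1 : R.card ≤ cc H - 1 := by
    refine Finset.card_image_le.trans ?_
    rw [Finset.card_erase_of_mem (mem_univ _), cc, Nat.card_eq_fintype_card, Finset.card_univ]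
  have h2 := Finset.card_union_le (edges H) R
  have h3 := one_le_cc H
  omega

/-- Removing edges from a tree produces as many new components. -/
theorem card_add_one_le_cc [Finite V] {T : SimpleGraph V} (hT : T.IsTree) (S : Finset (Sym2 V))
    (hS : S ⊆ edges T) : S.card + 1 ≤ cc (T.deleteEdges S) := by
  classical
  have := hT.connected.nonempty
  have h := card_le_edges_add_cc (T.deleteEdges S)
  have h1 : edges (T.deleteEdges S) = edges T \ S := by ext e; simp
  rw [h1, Finset.card_sdiff_of_subset hS, ← isTree_card_edges hT] at h
  have := Finset.card_le_card hS
  omega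

/-- The new edge joins two components of a forest, so no cycle arises. A spanning tree containing
the result has no more edges than the result itself, so the two coincide. -/
theorem isTree_swapEdge [Finite V] {T : SimpleGraph V} (hT : T.IsTree) {e : Sym2 V}
    (he : e ∈ T.edgeSet) {u v : V} (huv : ¬ (T.deleteEdges {e}).Reachable u v) :
    (swapEdge T (e, s(u, v))).IsTree := by
  classical
  have hne : u ≠ v := fun h => huv (h ▸ SimpleGraph.Reachable.refl _)
  have hac := SimpleGraph.IsAcyclic.sup_edge_of_not_reachable huv
    (hT.isAcyclic.anti (SimpleGraph.deleteEdges_le _))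
  have heq : swapEdge T (e, s(u, v)) = T.deleteEdges {e} ⊔ SimpleGraph.edge u v := by
    ext a b
    simp only [swapEdge, SimpleGraph.fromEdgeSet_adj, SimpleGraph.sup_adj,
      SimpleGraph.deleteEdges_adj, SimpleGraph.edge_adj, Set.mem_insert_iff, Set.mem_sdiff,
      SimpleGraph.mem_edgeSet, Set.mem_singleton_iff, Sym2.eq_iff]
    constructor
    · rintro ⟨h | h, hab⟩
      · exact Or.inr ⟨by tauto, hab⟩
      · exact Or.inl h
    · rintro (h | ⟨h, hab⟩)
      · exact ⟨Or.inr h, h.1.ne⟩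
      · exact ⟨Or.inl (by tauto), hab⟩
  rw [heq]
  set H := T.deleteEdges {e} ⊔ SimpleGraph.edge u v
  have := hT.connected.nonempty
  obtain ⟨F, hHF, -, hF⟩ := SimpleGraph.Connected.exists_isTree_le_of_le_of_isAcyclic
    (SimpleGraph.connected_top (V := V)) (le_top (a := H)) hac
  have hsub : edges H ⊆ edges F := fun x hx => mem_edges.2
    (SimpleGraph.edgeSet_mono hHF (mem_edges.1 hx))
  have hcard : (edges T).card ≤ (edges H).card := by
    have hH : insert s(u, v) ((edges T).erase e) ⊆ edges H := by
      intro x hx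
      rw [mem_edges, SimpleGraph.edgeSet_sup, SimpleGraph.edgeSet_deleteEdges]
      rcases Finset.mem_insert.1 hx with rfl | hx
      · right
        rw [SimpleGraph.mem_edgeSet, SimpleGraph.edge_adj]
        exact ⟨Or.inl ⟨rfl, rfl⟩, hne⟩
      · left
        exact ⟨mem_edges.1 (Finset.mem_of_mem_erase hx), Finset.ne_of_mem_erase hx⟩
    refine le_trans ?_ (Finset.card_le_card hH)
    rw [Finset.card_insert_of_notMem, Finset.card_erase_of_mem (mem_edges.2 he)]
    · omega
    · intro hmem
      refine huv (SimpleGraph.Adj.reachable ?_)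
      rw [SimpleGraph.deleteEdges_adj]
      exact ⟨mem_edges.1 (Finset.mem_of_mem_erase hmem), Finset.ne_of_mem_erase hmem⟩
  have hEq : edges H = edges F := Finset.eq_of_subset_of_card_le hsub (by
    have h1 := isTree_card_edges hT
    have h2 := isTree_card_edges hF
    omega)
  have : H = F := by
    rw [← SimpleGraph.edgeSet_inj]
    ext x
    rw [← mem_edges, ← mem_edges, hEq]
  exact this ▸ hF

/-- In a tree, two vertices that are separated by deleting a set of edges are separated by
deleting one of them. -/
theorem exists_not_reachable_deleteEdges {T : SimpleGraph V} (hT : T.IsTree)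
    {S : Set (Sym2 V)} {u v : V} (h : ¬ (T.deleteEdges S).Reachable u v) :
    ∃ e ∈ S, e ∈ T.edgeSet ∧ ¬ (T.deleteEdges {e}).Reachable u v := by
  classical
  obtain ⟨p, hp⟩ := hT.connected.exists_isPath u v
  obtain ⟨e, heS, hep⟩ := p.exists_mem_edges_of_not_reachable_deleteEdges h
  refine ⟨e, heS, p.edges_subset_edgeSet hep, fun hr => ?_⟩
  induction e with | h a b => ?_
  obtain ⟨q, hq⟩ := SimpleGraph.reachable_deleteEdges_iff_exists_walk.1 hr
  have := (hT.isAcyclic.subsingleton_path u v).elim ⟨p, hp⟩ q.toPath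
  have h2 : p = q.bypass := congrArg Subtype.val this
  exact hq (q.edges_bypass_subset_edges (h2 ▸ hep))

/-- A spanning tree of a quotient, with a lift of its edges. -/
theorem exists_tree_lift {W : SimpleGraph V} (hW : W.Connected) {f : V → κ}
    (hf : Function.Surjective f) : ∃ (Γ : SimpleGraph κ) (lift : Sym2 κ → Sym2 V), Γ.IsTree ∧
      ∀ e ∈ Γ.edgeSet, lift e ∈ W.edgeSet ∧ (lift e).map f = e := by
  classical
  obtain ⟨Γ, hle, hΓ⟩ := (connected_map hW hf).exists_isTree_le
  have hl : ∀ e : Sym2 κ, ∃ e' : Sym2 V, e ∈ Γ.edgeSet → e' ∈ W.edgeSet ∧ e'.map f = e := by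
    intro e
    induction e with | h a b => ?_
    by_cases hab : Γ.Adj a b
    · obtain ⟨-, u, v, huv, rfl, rfl⟩ := (SimpleGraph.map_adj' _ _ _ _).1 (hle hab)
      exact ⟨s(u, v), fun _ => ⟨huv, rfl⟩⟩
    · have := hW.nonempty
      exact ⟨s(Classical.arbitrary V, Classical.arbitrary V), fun h => (hab h).elim⟩
  choose lift hlift using hl
  exact ⟨Γ, lift, hΓ, hlift⟩

end Graphs


/-! ### Edge lengths, threshold graphs and minimum spanning trees. -/

section Lengths

variable {V X : Type*} [MetricSpace X]

/-- The length of an edge. -/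
noncomputable def len (p : V → X) : Sym2 V → ℝ :=
  Sym2.lift ⟨fun u v => dist (p u) (p v), fun u v => dist_comm (p u) (p v)⟩

@[simp] theorem len_mk (p : V → X) (u v : V) : len p s(u, v) = dist (p u) (p v) := rfl

theorem len_nonneg (p : V → X) (e : Sym2 V) : 0 ≤ len p e := by
  induction e with | h _ _ => exact dist_nonneg

theorem len_pos {p : V → X} (hp : Function.Injective p) {e : Sym2 V} (he : ¬ e.IsDiag) :
    0 < len p e := by
  induction e with | h _ _ => exact dist_pos.2 fun h => he (hp h)

theorem len_pos_of_mem {p : V → X} (hp : Function.Injective p) {T : SimpleGraph V} {e : Sym2 V}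
    (he : e ∈ T.edgeSet) : 0 < len p e :=
  len_pos hp (T.not_isDiag_of_mem_edgeSet he)

theorem len_map {U : Type*} (p : V → X) (f : U → V) (e : Sym2 U) :
    len p (e.map f) = len (p ∘ f) e := by
  induction e with | h u v => rfl

theorem cost_eq [Fintype V] (p : V → X) (G : SimpleGraph V) :
    cost p G = ∑ e ∈ edges G, len p e := by
  classical
  unfold cost
  refine Finset.sum_congr ?_ fun _ _ => rfl
  ext e
  simp

/-- The edges of length at least `r`. -/
noncomputable def longEdges [Finite V] (p : V → X) (T : SimpleGraph V) (r : ℝ) :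
    Finset (Sym2 V) := (edges T).filter fun e => r ≤ len p e

theorem mem_longEdges [Finite V] {p : V → X} {T : SimpleGraph V} {r : ℝ} {e : Sym2 V} :
    e ∈ longEdges p T r ↔ e ∈ T.edgeSet ∧ r ≤ len p e := by simp [longEdges]

/-- The graph in which two points are adjacent if their distance is less than `r`. -/
def thr (p : V → X) (r : ℝ) : SimpleGraph V where
  Adj u v := u ≠ v ∧ dist (p u) (p v) < r
  symm := ⟨fun _ _ h => ⟨h.1.symm, dist_comm (p _) (p _) ▸ h.2⟩⟩
  loopless := ⟨fun _ h => h.1 rfl⟩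

theorem thr_mono (p : V → X) {r s : ℝ} (h : r ≤ s) : thr p r ≤ thr p s :=
  fun _ _ huv => ⟨huv.1, huv.2.trans_le h⟩

theorem cc_thr_le [Finite V] {W : SimpleGraph V} (hW : W.Connected) (p : V → X) (r : ℝ) :
    cc (thr p r) ≤ (longEdges p W r).card + 1 :=
  cc_le_card_add_one hW _ fun _ _ huv hn => mem_longEdges.2
    ⟨huv, not_lt.1 fun h => hn ⟨huv.ne, h⟩⟩

/-- By `h`, deleting all long edges separates no two points at distance less than `s`, so each
component of `thr p s` stays within one of the pieces. -/
theorem card_longEdges_le [Finite V] {T : SimpleGraph V} (hT : T.IsTree) {p : V → X} {r s : ℝ}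
    (h : ∀ e ∈ T.edgeSet, r ≤ len p e → ∀ u v, ¬ (T.deleteEdges {e}).Reachable u v →
      s ≤ dist (p u) (p v)) :
    (longEdges p T r).card + 1 ≤ cc (thr p s) := by
  refine (card_add_one_le_cc hT (longEdges p T r) (Finset.filter_subset _ _)).trans
    (cc_le_of_adj_reachable fun u v huv => ?_)
  by_contra hn
  obtain ⟨e, heS, heT, he⟩ := exists_not_reachable_deleteEdges hT hn
  exact (h e heT (mem_longEdges.1 heS).2 u v he).not_gt huv.2

theorem edges_swapEdge [Finite V] [DecidableEq V] {T : SimpleGraph V} {e f : Sym2 V}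
    (hf : ¬ f.IsDiag) : edges (swapEdge T (e, f)) = insert f ((edges T).erase e) := by
  ext x
  simp only [mem_edges, swapEdge, SimpleGraph.edgeSet_fromEdgeSet, Set.mem_sdiff,
    Set.mem_insert_iff, Finset.mem_insert, Finset.mem_erase, Set.mem_singleton_iff]
  constructor
  · rintro ⟨h | h, -⟩
    · exact Or.inl h
    · exact Or.inr ⟨h.2, h.1⟩
  · rintro (h | h)
    · subst h; exact ⟨Or.inl rfl, hf⟩
    · exact ⟨Or.inr ⟨h.2, h.1⟩, T.not_isDiag_of_mem_edgeSet h.2⟩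

theorem sum_edges_swapEdge [Finite V] {T : SimpleGraph V} {e f : Sym2 V} (he : e ∈ T.edgeSet)
    (hf : f ∉ T.edgeSet) (hd : ¬ f.IsDiag) (F : Sym2 V → ℝ) :
    ∑ x ∈ edges (swapEdge T (e, f)), F x = ∑ x ∈ edges T, F x - F e + F f := by
  classical
  rw [edges_swapEdge hd, Finset.sum_insert (fun h => hf (mem_edges.1 (Finset.mem_of_mem_erase h))),
    ← Finset.add_sum_erase _ _ (mem_edges.2 he)]
  ring

/-- A tree of minimal cost has as few edges of every length as possible. -/
theorem exists_min_tree [Finite V] [Nonempty V] (p : V → X) :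
    ∃ W : SimpleGraph V, W.IsTree ∧ ∀ r, (longEdges p W r).card + 1 = cc (thr p r) := by
  obtain ⟨W, hW, hmin⟩ := Set.exists_min_image {T : SimpleGraph V | T.IsTree}
    (fun T => ∑ e ∈ edges T, len p e) (Set.toFinite _)
    (by
      obtain ⟨T, -, hT⟩ := (SimpleGraph.connected_top (V := V)).exists_isTree_le
      exact ⟨T, hT⟩)
  refine ⟨W, hW, fun r => le_antisymm (card_longEdges_le hW ?_) (cc_thr_le hW.connected p r)⟩
  -- The pair `s(u, v)` could replace `e`, so minimality makes it at least as long as `e`.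
  intro e he hr u v huv
  refine hr.trans ?_
  by_cases huvW : s(u, v) ∈ W.edgeSet
  · by_cases h : s(u, v) = e
    · rw [← h, len_mk]
    · exact (huv (SimpleGraph.Adj.reachable
        ((SimpleGraph.deleteEdges_adj).2 ⟨huvW, h⟩))).elim
  · have hne : u ≠ v := fun h => huv (h ▸ SimpleGraph.Reachable.refl _)
    have := hmin _ (isTree_swapEdge hW he huv)
    rw [sum_edges_swapEdge he huvW (by simpa using hne), len_mk] at this
    linarith

end Lengths

/-! ### Attaching a new leaf. -/

section Attach

theorem edges_attach {n : ℕ} (T : SimpleGraph (Fin (n + 1))) (q : Fin (n + 1)) :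
    edges (attach T q) = insert s(q.castSucc, Fin.last (n + 1))
      ((edges T).image (Sym2.map Fin.castSucc)) := by
  ext e
  rw [mem_edges, attach, SimpleGraph.edgeSet_sup, Set.mem_union, Finset.mem_insert,
    Finset.mem_image, or_comm]
  refine or_congr ?_ ?_
  · induction e with | h a b => ?_
    rw [SimpleGraph.mem_edgeSet, SimpleGraph.edge_adj, Sym2.eq_iff]
    constructor
    · rintro ⟨h, -⟩; exact h
    · intro h
      refine ⟨h, ?_⟩
      rcases h with ⟨rfl, rfl⟩ | ⟨rfl, rfl⟩
      · exact (Fin.castSucc_lt_last q).ne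
      · exact (Fin.castSucc_lt_last q).ne'
  · have h := SimpleGraph.edgeSet_map (Fin.castSuccEmb (n := n + 1)) T
    have h2 : ⇑(Fin.castSuccEmb (n := n + 1)) = (Fin.castSucc : Fin (n + 1) → _) := rfl
    rw [h2] at h
    rw [h, Set.mem_image]
    simp only [mem_edges]
    rfl

theorem sum_edges_attach {n : ℕ} (T : SimpleGraph (Fin (n + 1))) (q : Fin (n + 1))
    (F : Sym2 (Fin (n + 2)) → ℝ) :
    ∑ e ∈ edges (attach T q), F e =
      F s(q.castSucc, Fin.last (n + 1)) + ∑ e ∈ edges T, F (e.map Fin.castSucc) := by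
  rw [edges_attach, Finset.sum_insert, Finset.sum_image]
  · exact fun a _ b _ h => Sym2.map.injective (Fin.castSucc_injective _) h
  · intro h
    obtain ⟨e, -, he⟩ := Finset.mem_image.1 h
    induction e with | h a b => ?_
    rw [Sym2.map_mk, Sym2.eq_iff] at he
    rcases he with ⟨-, h⟩ | ⟨h, -⟩
    · exact (Fin.castSucc_lt_last b).ne h
    · exact (Fin.castSucc_lt_last a).ne h

theorem isTree_attach {n : ℕ} {T : SimpleGraph (Fin (n + 1))} (hT : T.IsTree)
    (q : Fin (n + 1)) : (attach T q).IsTree := by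
  have hreach : ∀ v, (attach T q).Reachable q.castSucc v := by
    intro v
    induction v using Fin.lastCases with
    | last =>
      refine SimpleGraph.Adj.reachable (Or.inr ?_)
      rw [SimpleGraph.edge_adj]
      exact ⟨Or.inl ⟨rfl, rfl⟩, (Fin.castSucc_lt_last q).ne⟩
    | cast v => exact (reachable_map Fin.castSucc (hT.connected.preconnected q v)).mono le_sup_left
  refine isTree_of_connected_card ((SimpleGraph.connected_iff _).2
    ⟨fun u v => (hreach u).symm.trans (hreach v), inferInstance⟩) ?_
  have h := sum_edges_attach T q (fun _ => 1)
  have h2 := isTree_card_edges hT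
  simp only [Finset.sum_const, nsmul_eq_mul, mul_one] at h
  have h3 : (edges (attach T q)).card = 1 + (edges T).card := by exact_mod_cast h
  rw [Nat.card_eq_fintype_card, Fintype.card_fin] at *
  omega

end Attach


/-! ### From counting inequalities at every level to inequalities between sums. -/

section Counting

/-- Integration of an inequality between counting functions. -/
theorem sum_le_of_card_le {α β : Type*} (I : Finset α) (J : Finset β) (c : ℝ) (a : α → ℝ)
    (F : β → ℝ → ℝ≥0∞) (B : β → ℝ) (hF : ∀ j ∈ J, Measurable (F j)) (hB : ∀ j ∈ J, 0 ≤ B j)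
    (hFB : ∀ j ∈ J, ∫⁻ s, F j s ≤ ENNReal.ofReal (B j))
    (h : ∀ s, c < s → ((I.filter fun i => s < a i).card : ℝ≥0∞) ≤ ∑ j ∈ J, F j s) :
    ∑ i ∈ I, max (a i - c) 0 ≤ ∑ j ∈ J, B j := by
  have h1 : ∀ s, ∑ i ∈ I, (Set.Ioo c (a i)).indicator (fun _ => (1 : ℝ≥0∞)) s
      ≤ ∑ j ∈ J, F j s := by
    intro s
    by_cases hs : c < s
    · refine le_trans (le_of_eq ?_) (h s hs)
      rw [Finset.natCast_card_filter]
      refine Finset.sum_congr rfl fun i _ => ?_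
      simp [Set.indicator_apply, hs]
    · refine le_trans (le_of_eq ?_) zero_le
      refine Finset.sum_eq_zero fun i _ => ?_
      simp [hs]
  have h2 := lintegral_mono (μ := volume) h1
  rw [lintegral_finsetSum _ (fun j _ => measurable_const.indicator measurableSet_Ioo),
    lintegral_finsetSum _ hF] at h2
  have h3 : ∑ i ∈ I, ENNReal.ofReal (max (a i - c) 0) ≤ ∑ j ∈ J, ENNReal.ofReal (B j) := by
    refine le_trans (le_of_eq ?_) (h2.trans (Finset.sum_le_sum hFB))
    refine Finset.sum_congr rfl fun i _ => ?_
    rw [lintegral_indicator_const measurableSet_Ioo, Real.volume_Ioo, one_mul]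
    rcases le_total (a i - c) 0 with hh | hh
    · rw [max_eq_right hh, ENNReal.ofReal_of_nonpos hh, ENNReal.ofReal_zero]
    · rw [max_eq_left hh]
  rw [← ENNReal.ofReal_sum_of_nonneg (fun _ _ => le_max_right _ _),
    ← ENNReal.ofReal_sum_of_nonneg hB] at h3
  exact (ENNReal.ofReal_le_ofReal_iff (Finset.sum_nonneg hB)).1 h3

/-- The positive part of `log (a / M)`, for `a` and `M` positive. -/
noncomputable def logExcess (M a : ℝ) : ℝ := max (Real.log a - Real.log M) 0

theorem logExcess_nonneg (M a : ℝ) : 0 ≤ logExcess M a := le_max_right _ _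

/-- Integrate the hypothesis over `s = log r`: the condition `r / K ≤ b j` then reads `s ≤ log (b j)
+ log K`. -/
theorem sum_logExcess_le {α β : Type*} (I : Finset α) (J : Finset β) (a : α → ℝ) (b : β → ℝ)
    {L K : ℝ} (hL : 0 < L) (hK : 0 < K) (ha : ∀ i ∈ I, 0 < a i) (hb : ∀ j ∈ J, 0 < b j)
    (h : ∀ r, L ≤ r → (I.filter fun i => r ≤ a i).card ≤ (J.filter fun j => r / K ≤ b j).card) :
    ∑ i ∈ I, logExcess L (a i) ≤ ∑ j ∈ J, logExcess (L / K) (b j) := by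
  refine sum_le_of_card_le I J (Real.log L) (fun i => Real.log (a i))
    (fun j => (Set.Ioc (Real.log L) (Real.log (b j) + Real.log K)).indicator fun _ => 1) _
    (fun j _ => measurable_const.indicator measurableSet_Ioc) (fun j _ => logExcess_nonneg _ _)
    (fun j _ => ?_) (fun s hs => ?_)
  · rw [lintegral_indicator_const measurableSet_Ioc, Real.volume_Ioc, one_mul]
    refine ENNReal.ofReal_le_ofReal ?_
    rw [logExcess, Real.log_div hL.ne' hK.ne']
    exact le_max_of_le_left (by linarith)
  · have h1 := h (Real.exp s) ((Real.log_le_iff_le_exp hL).1 hs.le)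
    have h2 : (I.filter fun i => s < Real.log (a i)).card ≤
        (I.filter fun i => Real.exp s ≤ a i).card := Finset.card_le_card fun i hi => by
      rw [Finset.mem_filter] at hi ⊢
      exact ⟨hi.1, ((Real.lt_log_iff_exp_lt (ha i hi.1)).1 hi.2).le⟩
    refine le_trans (Nat.cast_le.2 (h2.trans h1)) ?_
    rw [Finset.natCast_card_filter]
    refine Finset.sum_le_sum fun j hj => ?_
    split_ifs with hc
    · rw [Set.indicator_of_mem]
      refine ⟨hs, ?_⟩
      rw [div_le_iff₀ hK, ← Real.le_log_iff_exp_le (mul_pos (hb j hj) hK),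
        Real.log_mul (hb j hj).ne' hK.ne'] at hc
      exact hc
    · exact zero_le

/-- Again integrate over `s = log r`. While `r ≤ b j` the index `j` counts once, which yields
`logExcess`; afterwards it counts `2 * b j * exp (-s)`, whose integral over `s > log (b j)` is 2. -/
theorem sum_logExcess_le_add_two {α β : Type*} (I : Finset α) (J : Finset β) (a : α → ℝ)
    (b : β → ℝ) {M : ℝ} (hM : 0 < M) (ha : ∀ i ∈ I, 0 < a i) (hb : ∀ j ∈ J, 0 < b j)
    (h : ∀ r, M ≤ r → ((I.filter fun i => r ≤ a i).card : ℝ) ≤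
      (J.filter fun j => r ≤ b j).card + 2 / r * ∑ j ∈ J.filter (fun j => b j < r), b j) :
    ∑ i ∈ I, logExcess M (a i) ≤ ∑ j ∈ J, (logExcess M (b j) + 2) := by
  refine sum_le_of_card_le I J (Real.log M) (fun i => Real.log (a i))
    (fun j s => (Set.Ioc (Real.log M) (Real.log (b j))).indicator (fun _ => 1) s +
      (Set.Ioi (Real.log (b j))).indicator
        (fun s => ENNReal.ofReal (2 * b j * Real.exp (-s))) s) _
    (fun j _ => (measurable_const.indicator measurableSet_Ioc).add
      (Measurable.indicator (by fun_prop) measurableSet_Ioi))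
    (fun j _ => add_nonneg (logExcess_nonneg _ _) zero_le_two)
    (fun j hj => ?_) (fun s hs => ?_)
  · rw [lintegral_add_left (measurable_const.indicator measurableSet_Ioc),
      lintegral_indicator_const measurableSet_Ioc, Real.volume_Ioc, one_mul,
      lintegral_indicator measurableSet_Ioi, ENNReal.ofReal_add (logExcess_nonneg _ _) zero_le_two]
    refine add_le_add (ENNReal.ofReal_le_ofReal (le_max_left _ _)) ?_
    rw [← ofReal_integral_eq_lintegral_ofReal, integral_const_mul, integral_exp_neg_Ioi,
      Real.exp_neg, Real.exp_log (hb j hj), mul_assoc, mul_inv_cancel₀ (hb j hj).ne', mul_one]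
    · exact (integrableOn_exp_neg_Ioi _).const_mul _
    · exact Filter.Eventually.of_forall fun s =>
        mul_nonneg (mul_nonneg zero_le_two (hb j hj).le) (Real.exp_pos _).le
  · have h1 := h (Real.exp s) ((Real.log_le_iff_le_exp hM).1 hs.le)
    have h2 : (I.filter fun i => s < Real.log (a i)).card ≤
        (I.filter fun i => Real.exp s ≤ a i).card := Finset.card_le_card fun i hi => by
      rw [Finset.mem_filter] at hi ⊢
      exact ⟨hi.1, ((Real.lt_log_iff_exp_lt (ha i hi.1)).1 hi.2).le⟩
    have h3 : ((I.filter fun i => s < Real.log (a i)).card : ℝ) ≤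
        ∑ j ∈ J, if Real.exp s ≤ b j then 1 else 2 * b j * Real.exp (-s) := by
      refine (Nat.cast_le.2 h2).trans (h1.trans (le_of_eq ?_))
      rw [Finset.natCast_card_filter, Finset.sum_filter, Finset.mul_sum, ← Finset.sum_add_distrib]
      refine Finset.sum_congr rfl fun j _ => ?_
      by_cases hc : Real.exp s ≤ b j
      · simp [hc, not_lt.2 hc]
      · rw [if_neg hc, if_neg hc, if_pos (not_le.1 hc), Real.exp_neg]
        ring
    have h4 : ((I.filter fun i => s < Real.log (a i)).card : ℝ≥0∞) ≤
        ENNReal.ofReal (∑ j ∈ J, if Real.exp s ≤ b j then 1 else 2 * b j * Real.exp (-s)) := by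
      rw [← ENNReal.ofReal_natCast]
      exact ENNReal.ofReal_le_ofReal h3
    refine h4.trans ?_
    rw [ENNReal.ofReal_sum_of_nonneg]
    · refine Finset.sum_le_sum fun j hj => ?_
      split_ifs with hc
      · rw [Set.indicator_of_mem, ENNReal.ofReal_one]
        · exact le_self_add
        · exact ⟨hs, (Real.le_log_iff_exp_le (hb j hj)).2 hc⟩
      · rw [Set.indicator_of_mem (s := Set.Ioi _)]
        · exact le_add_self
        · exact (Real.log_lt_iff_lt_exp (hb j hj)).2 (not_le.1 hc)
    · intro j hj
      split_ifs
      · exact zero_le_one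
      · exact mul_nonneg (mul_nonneg zero_le_two (hb j hj).le) (Real.exp_pos _).le

end Counting

/-! ### Labelling points by growing balls. -/

section Labels

variable {X ι Y : Type*} [MetricSpace X]

open Classical in
/-- The label of a point `z` at level `s`: the label `q i` of some active owner `i ∈ R` within
distance `s` of `z`. -/
noncomputable def label (x : ι → X) (R : Set ι) (q : ι → Y) (s : ℝ) (z : X) : Option Y :=
  if h : ∃ i ∈ R, dist z (x i) ≤ s then some (q h.choose) else none

/-- Two owners within `s` of `z` are within `2 * s` of each other, so the arbitrary choice of an
owner is immaterial. -/
theorem label_eq {x : ι → X} {R : Set ι} {q : ι → Y} {s : ℝ} {z : X}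
    (hq : ∀ i ∈ R, ∀ j ∈ R, dist (x i) (x j) ≤ 2 * s → q i = q j) {i : ι} (hi : i ∈ R)
    (h : dist z (x i) ≤ s) : label x R q s z = some (q i) := by
  have hex : ∃ i ∈ R, dist z (x i) ≤ s := ⟨i, hi, h⟩
  rw [label, dif_pos hex]
  congr 1
  refine hq _ hex.choose_spec.1 _ hi ?_
  have h1 := hex.choose_spec.2
  have h2 := dist_triangle_left (x hex.choose) (x i) z
  linarith

theorem exists_of_label_ne {x : ι → X} {R : Set ι} {q : ι → Y} {s : ℝ} {z w : X}
    (h : label x R q s z ≠ label x R q s w) :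
    ∃ i ∈ R, dist z (x i) ≤ s ∨ dist w (x i) ≤ s := by
  by_contra! hn
  refine h ?_
  rw [label, label, dif_neg, dif_neg]
  · rintro ⟨i, hi, hw⟩
    exact (hn i hi).2.not_ge hw
  · rintro ⟨i, hi, hw⟩
    exact (hn i hi).1.not_ge hw

/-- If the set of active owners grows with the level, then two points have different labels
only during a range of levels no longer than their distance. -/
theorem label_ne_subset_Icc {Y : ℝ → Type*} (x : ι → X) (D : Set ℝ) (R : ℝ → Set ι)
    (q : ∀ s, ι → Y s) (hD : ∀ s ∈ D, 0 < s) (hR : ∀ s ∈ D, ∀ s' ∈ D, s ≤ s' → R s ⊆ R s')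
    (hq : ∀ s ∈ D, ∀ i ∈ R s, ∀ j ∈ R s, dist (x i) (x j) ≤ 2 * s → q s i = q s j) (z w : X) :
    ∃ ρ, ∀ s ∈ D, label x (R s) (q s) s z ≠ label x (R s) (q s) s w →
      s ∈ Set.Icc ρ (ρ + dist z w) := by
  -- `Z` consists of the levels at which some active ball reaches `z` or `w`. Once `dist z w`
  -- further levels have passed, such a ball, whose owner is still active by `hR`, contains both
  -- points, and the labels agree.
  set Z : Set ℝ := {s | s ∈ D ∧ ∃ i ∈ R s, dist z (x i) ≤ s ∨ dist w (x i) ≤ s} with hZ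
  have hbdd : BddBelow Z := ⟨0, fun s hs => (hD s hs.1).le⟩
  refine ⟨sInf Z, fun s hs hne => ?_⟩
  have hsZ : s ∈ Z := ⟨hs, exists_of_label_ne hne⟩
  refine ⟨csInf_le hbdd hsZ, ?_⟩
  by_contra! hlt
  obtain ⟨s', ⟨hs', i, hi, hzw⟩, hlt'⟩ := exists_lt_of_csInf_lt ⟨s, hsZ⟩
    (show sInf Z < s - dist z w by linarith)
  have hd := dist_nonneg (x := z) (y := w)
  have hiR := hR s' hs' s hs (by linarith) hi
  have h1 : dist z (x i) ≤ s ∧ dist w (x i) ≤ s := by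
    rcases hzw with h | h
    · have := dist_triangle_left w (x i) z
      constructor <;> linarith
    · have := dist_triangle z w (x i)
      constructor <;> linarith
  exact hne ((label_eq (hq s hs) hiR h1.1).trans (label_eq (hq s hs) hiR h1.2).symm)

/-- The same for the two ends of an edge. -/
theorem exists_label_interval {V : Type*} {Y : ℝ → Type*} (x : ι → X) (D : Set ℝ)
    (R : ℝ → Set ι) (q : ∀ s, ι → Y s) (hD : ∀ s ∈ D, 0 < s)
    (hR : ∀ s ∈ D, ∀ s' ∈ D, s ≤ s' → R s ⊆ R s')
    (hq : ∀ s ∈ D, ∀ i ∈ R s, ∀ j ∈ R s, dist (x i) (x j) ≤ 2 * s → q s i = q s j)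
    (p : V → X) :
    ∃ ρ : Sym2 V → ℝ, ∀ s ∈ D, ∀ u v,
      label x (R s) (q s) s (p u) ≠ label x (R s) (q s) s (p v) →
      s ∈ Set.Icc (ρ s(u, v)) (ρ s(u, v) + len p s(u, v)) := by
  have h : ∀ e : Sym2 V, ∃ ρ : ℝ, ∀ s ∈ D, ∀ u v, e = s(u, v) →
      label x (R s) (q s) s (p u) ≠ label x (R s) (q s) s (p v) →
      s ∈ Set.Icc ρ (ρ + len p e) := by
    intro e
    induction e with | h u v => ?_
    obtain ⟨ρ, hρ⟩ := label_ne_subset_Icc x D R q hD hR hq (p u) (p v)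
    refine ⟨ρ, fun s hs u' v' he hne => hρ s hs ?_⟩
    rcases Sym2.eq_iff.1 he with ⟨rfl, rfl⟩ | ⟨rfl, rfl⟩
    · exact hne
    · exact hne.symm
  choose ρ hρ using h
  exact ⟨ρ, fun s hs u v hne => hρ _ s hs u v rfl hne⟩

end Labels

/-! ### Lower bound for Steiner trees. -/

section Moat

variable {X : Type*} [MetricSpace X]

/-- The points `x 0, …, x n`. -/
def pts (x : ℕ → X) (n : ℕ) : Fin (n + 1) → X := fun i => x i

theorem reachable_thr_of_dist_lt {x : ℕ → X} {t : ℕ} {r : ℝ} {i j : ℕ} (hi : i ≤ t) (hj : j ≤ t)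
    (h : dist (x i) (x j) < r) :
    (thr (pts x t) r).connectedComponentMk (Fin.ofNat (t + 1) i) =
      (thr (pts x t) r).connectedComponentMk (Fin.ofNat (t + 1) j) := by
  rw [SimpleGraph.ConnectedComponent.eq]
  by_cases hij : i = j
  · rw [hij]
  · refine SimpleGraph.Adj.reachable ⟨fun h => hij ?_, ?_⟩
    · have := congrArg Fin.val h
      simpa [Nat.mod_eq_of_lt (Nat.lt_succ_of_le hi), Nat.mod_eq_of_lt (Nat.lt_succ_of_le hj)]
        using this
    · simpa [pts, Nat.mod_eq_of_lt (Nat.lt_succ_of_le hi),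
        Nat.mod_eq_of_lt (Nat.lt_succ_of_le hj)] using h

/-- Every connected graph through the points `x 0, …, x n` pays for the components at all levels,
where the set of points considered may grow with the level. -/
theorem exists_moats (x : ℕ → X) (n : ℕ) {V : Type*} [Finite V] (p : V → X)
    (hp : ∀ i ≤ n, ∃ v, p v = x i) {G : SimpleGraph V} (hG : G.Connected) (t : ℝ → ℕ)
    (htn : ∀ s, t s ≤ n) (ht : ∀ s s', 0 < s → s ≤ s' → t s ≤ t s') :
    ∃ ρ : Sym2 V → ℝ, ∀ s, 0 < s → cc (thr (pts x (t s)) (3 * s)) ≤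
      ((edges G).filter fun e => s ∈ Set.Icc (ρ e) (ρ e + len p e)).card + 1 := by
  classical
  let Y : ℝ → Type := fun s => (thr (pts x (t s)) (3 * s)).ConnectedComponent
  let q : ∀ s, ℕ → Y s := fun s i =>
    (thr (pts x (t s)) (3 * s)).connectedComponentMk (Fin.ofNat (t s + 1) i)
  -- The threshold `3 * s` leaves room above `2 * s`, because adjacency in `thr` requires a strict
  -- inequality.
  have hq : ∀ s ∈ Set.Ioi (0 : ℝ), ∀ i ∈ Set.Iic (t s), ∀ j ∈ Set.Iic (t s),
      dist (x i) (x j) ≤ 2 * s → q s i = q s j := fun s hs i hi j hj hij =>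
    reachable_thr_of_dist_lt hi hj (by have : 0 < s := hs; linarith)
  obtain ⟨ρ, hρ⟩ := exists_label_interval x (Set.Ioi 0) (fun s => Set.Iic (t s)) q
    (fun s hs => hs) (fun s hs s' _ hss => Set.Iic_subset_Iic.2 (ht s s' hs hss)) hq p
  refine ⟨ρ, fun s hs => ?_⟩
  have hfin : Finite (Y s) := Quot.finite _
  refine le_trans ?_ (ncard_range_le hG (fun v => label x (Set.Iic (t s)) (q s) s (p v)) _
    fun u v huv hne => Finset.mem_filter.2 ⟨mem_edges.2 huv, hρ s hs u v hne⟩)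
  rw [cc, ← Set.ncard_univ, ← Set.ncard_image_of_injective _ (Option.some_injective (Y s))]
  refine Set.ncard_le_ncard ?_ (Set.toFinite _)
  rintro _ ⟨c, -, rfl⟩
  induction c using SimpleGraph.ConnectedComponent.ind with | h v => ?_
  have hv : (v : ℕ) ≤ t s := Nat.lt_succ_iff.1 v.2
  obtain ⟨u, hu⟩ := hp v (hv.trans (htn s))
  refine ⟨u, ?_⟩
  have := label_eq (z := p u) (hq s hs) (i := (v : ℕ)) hv (by rw [hu, dist_self]; exact hs.le)
  refine this.trans ?_
  simp [q]

end Moat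


/-! ### Packing disjoint balls against a contracted spanning tree. -/

section Packing

variable {X : Type*} [MetricSpace X]

/-- The map that contracts the components of a graph on the vertices `0, …, t`. -/
def contract {t : ℕ} (n : ℕ) (H : SimpleGraph (Fin (t + 1))) (v : Fin (n + 1)) :
    H.ConnectedComponent ⊕ Fin (n - t) :=
  if h : (v : ℕ) ≤ t then .inl (H.connectedComponentMk ⟨v, Nat.lt_succ_of_le h⟩)
  else .inr ⟨v - t - 1, by omega⟩

theorem contract_surjective {t n : ℕ} (htn : t ≤ n) (H : SimpleGraph (Fin (t + 1))) :
    Function.Surjective (contract n H) := by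
  rintro (c | i)
  · induction c using SimpleGraph.ConnectedComponent.ind with | h v => ?_
    refine ⟨⟨v, by omega⟩, ?_⟩
    rw [contract, dif_pos (Nat.lt_succ_iff.1 v.2)]
  · refine ⟨⟨t + 1 + i, by omega⟩, ?_⟩
    rw [contract, dif_neg (by simp only; omega)]
    congr 1
    ext
    simp only
    omega

/-- The shortfall `k` left by the long edges must be covered by short edges at every `s` in an
interval of length `r / 2`, and a short edge `e` helps only during a time `ℓ e`. Truncated
subtraction makes `k` zero if the long edges suffice. -/
theorem card_filter_add_le {α : Type*} (E : Finset α) (ℓ ρ : α → ℝ) (N : ℕ) {r : ℝ} (hr : 0 < r)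
    (hℓ : ∀ e ∈ E, 0 ≤ ℓ e)
    (h : ∀ s ∈ Set.Ioo 0 (r / 2), N ≤ ((E.filter fun e => r ≤ ℓ e).card +
      ((E.filter fun e => ℓ e < r).filter fun e => s ∈ Set.Icc (ρ e) (ρ e + ℓ e)).card) + 1) :
    (N : ℝ) ≤ (E.filter fun e => r ≤ ℓ e).card + 2 / r * ∑ e ∈ E.filter (fun e => ℓ e < r), ℓ e
      + 1 := by
  set k := N - ((E.filter fun e => r ≤ ℓ e).card + 1) with hk
  have h1 := sum_le_of_card_le (Finset.range k) (E.filter fun e => ℓ e < r) 0 (fun _ => r / 2)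
    (fun e => (Set.Icc (ρ e) (ρ e + ℓ e)).indicator fun _ => 1) ℓ
    (fun j _ => measurable_const.indicator measurableSet_Icc)
    (fun j hj => hℓ j (Finset.mem_filter.1 hj).1)
    (fun j _ => by
      rw [lintegral_indicator_const measurableSet_Icc, Real.volume_Icc, one_mul,
        add_sub_cancel_left])
    (fun s hs => by
      by_cases hsr : s < r / 2
      · have h2 := h s ⟨hs, hsr⟩
        have h3 : ((Finset.range k).filter fun _ => s < r / 2).card ≤
            ((E.filter fun e => ℓ e < r).filter fun e =>
              s ∈ Set.Icc (ρ e) (ρ e + ℓ e)).card := by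
          refine (Finset.card_filter_le _ _).trans ?_
          rw [Finset.card_range]
          omega
        refine (Nat.cast_le.2 h3).trans (le_of_eq ?_)
        rw [Finset.natCast_card_filter]
        exact Finset.sum_congr rfl fun e _ => by rw [Set.indicator_apply]
      · simp [hsr])
  rw [Finset.sum_const, Finset.card_range, sub_zero, max_eq_left (by linarith), nsmul_eq_mul] at h1
  have h4 : (N : ℝ) ≤ k + ((E.filter fun e => r ≤ ℓ e).card + 1) := by
    exact_mod_cast (show N ≤ k + ((E.filter fun e => r ≤ ℓ e).card + 1) by omega)
  have h5 : (k : ℝ) ≤ 2 / r * ∑ e ∈ E.filter (fun e => ℓ e < r), ℓ e := by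
    rw [div_mul_eq_mul_div, le_div_iff₀ hr]
    linarith
  linarith

/-- A packing bound: the components of the points `x 0, …, x t` at the levels `r ≥ M`, together
with later points at distance at least `r` from all previous ones, against the edges of a tree
that remain after the components at level `M` have been contracted. -/
theorem exists_packing (x : ℕ → X) {t n : ℕ} (htn : t ≤ n) {W : SimpleGraph (Fin (n + 1))}
    (hW : W.Connected) (M : ℝ) (g : ℕ → ℝ)
    (hg : ∀ i, t < i → i ≤ n → ∀ j < i, g i ≤ dist (x i) (x j)) :
    ∃ E ⊆ edges W, E.card + 1 = cc (thr (pts x t) M) + (n - t) ∧ ∀ r, 0 < r → M ≤ r →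
      ((cc (thr (pts x t) r) + ((Finset.Ioc t n).filter fun i => r ≤ g i).card : ℕ) : ℝ) ≤
        (E.filter fun e => r ≤ len (pts x n) e).card +
        2 / r * ∑ e ∈ E.filter (fun e => len (pts x n) e < r), len (pts x n) e + 1 := by
  classical
  set f := contract n (thr (pts x t) M) with hf
  have hfs := contract_surjective htn (thr (pts x t) M)
  obtain ⟨Γ, lift, hΓ, hlift⟩ := exists_tree_lift hW hfs
  have hfin : Finite (thr (pts x t) M).ConnectedComponent := Quot.finite _
  have hinj : Set.InjOn lift (edges Γ) := fun a ha b hb hab => by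
    rw [← (hlift a (mem_edges.1 ha)).2, ← (hlift b (mem_edges.1 hb)).2, hab]
  refine ⟨(edges Γ).image lift, ?_, ?_, fun r hr hMr => ?_⟩
  · intro e he
    obtain ⟨a, ha, rfl⟩ := Finset.mem_image.1 he
    exact mem_edges.2 (hlift a (mem_edges.1 ha)).1
  · rw [Finset.card_image_of_injOn hinj, isTree_card_edges hΓ, Nat.card_sum, Nat.card_eq_fintype_card
      (α := Fin _), Fintype.card_fin, cc]
  have hfinr : Finite (thr (pts x t) r).ConnectedComponent := Quot.finite _
  have : Fintype (thr (pts x t) r).ConnectedComponent := Fintype.ofFinite _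
  set Y := (thr (pts x t) r).ConnectedComponent ⊕ ℕ
  -- The owners are the early points, labelled by their components at level `r`, and the later
  -- points that arrived at distance at least `r`, each labelled by itself.
  set R : Set ℕ := {i | i ≤ t ∨ (t < i ∧ i ≤ n ∧ r ≤ g i)} with hR
  set q : ℕ → Y := fun i => if i ≤ t then
    .inl ((thr (pts x t) r).connectedComponentMk (Fin.ofNat (t + 1) i)) else .inr i with hq
  have hfar : ∀ i ∈ R, t < i → ∀ j ∈ R, j < i → r ≤ dist (x i) (x j) := by
    intro i hi hti j _ hji
    have hi' : t < i ∧ i ≤ n ∧ r ≤ g i := hi.resolve_left (by omega)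
    exact hi'.2.2.trans (hg i hti hi'.2.1 j hji)
  have hsep : ∀ i ∈ R, ∀ j ∈ R, dist (x i) (x j) < r → q i = q j := by
    intro i hi j hj hij
    rcases lt_trichotomy i j with h | rfl | h
    · by_cases hjt : j ≤ t
      · have hit : i ≤ t := h.le.trans hjt
        simp only [hq, if_pos hit, if_pos hjt]
        rw [reachable_thr_of_dist_lt hit hjt hij]
      · have := hfar j hj (by omega) i hi h
        rw [dist_comm] at this
        linarith
    · rfl
    · by_cases hit : i ≤ t
      · have hjt : j ≤ t := h.le.trans hit
        simp only [hq, if_pos hit, if_pos hjt]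
        rw [reachable_thr_of_dist_lt hit hjt hij]
      · have := hfar i hi (by omega) j hj h
        linarith
  have hqD : ∀ s ∈ Set.Ioo 0 (r / 2), ∀ i ∈ R, ∀ j ∈ R, dist (x i) (x j) ≤ 2 * s → q i = q j :=
    fun s hs i hi j hj hij => hsep i hi j hj (by linarith [hs.2])
  obtain ⟨ρ, hρ⟩ := exists_label_interval (Y := fun _ => Y) x (Set.Ioo 0 (r / 2)) (fun _ => R)
    (fun _ => q) (fun s hs => hs.1) (fun _ _ _ _ _ => subset_rfl) hqD (pts x n)
  refine card_filter_add_le _ _ ρ _ hr (fun _ _ => len_nonneg _ _) fun s hs => ?_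
  have hown : ∀ i (hi : i < n + 1), i ∈ R → label x R q s (pts x n ⟨i, hi⟩) = some (q i) :=
    fun i hi hiR => label_eq (hqD s hs) hiR (by simpa [pts] using hs.1.le)
  -- Since `M ≤ r`, the label is constant on the contracted classes and descends to the quotient;
  -- only the edges of `Γ` have to be charged.
  have hfac : ∀ u v, f u = f v →
      label x R q s (pts x n u) = label x R q s (pts x n v) := by
    intro u v huv
    by_cases hu : (u : ℕ) ≤ t <;> by_cases hv : (v : ℕ) ≤ t
    · rw [hf, contract, contract, dif_pos hu, dif_pos hv, Sum.inl.injEq,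
        SimpleGraph.ConnectedComponent.eq] at huv
      rw [hown u u.2 (Or.inl hu), hown v v.2 (Or.inl hv)]
      simp only [hq, if_pos hu, if_pos hv]
      congr 2
      rw [SimpleGraph.ConnectedComponent.eq]
      convert huv.mono (thr_mono _ hMr) using 1 <;> ext <;> simp <;> omega
    · rw [hf, contract, contract, dif_pos hu, dif_neg hv] at huv
      cases huv
    · rw [hf, contract, contract, dif_neg hu, dif_pos hv] at huv
      cases huv
    · rw [hf, contract, contract, dif_neg hu, dif_neg hv, Sum.inr.injEq, Fin.mk.injEq] at huv
      have : u = v := by ext; omega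
      rw [this]
  set sec := Function.surjInv hfs with hsec
  have hsecf : ∀ u, label x R q s (pts x n (sec (f u))) = label x R q s (pts x n u) :=
    fun u => hfac _ _ (Function.surjInv_eq hfs (f u))
  have hmain := ncard_range_le hΓ.connected (fun k => label x R q s (pts x n (sec k)))
    ((edges Γ).filter fun e => r ≤ len (pts x n) (lift e) ∨ (len (pts x n) (lift e) < r ∧
      s ∈ Set.Icc (ρ (lift e)) (ρ (lift e) + len (pts x n) (lift e)))) (by
    intro k k' hkk hne
    rw [Finset.mem_filter]
    refine ⟨mem_edges.2 hkk, ?_⟩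
    rcases le_or_gt r (len (pts x n) (lift s(k, k'))) with hlr | hlr
    · exact Or.inl hlr
    refine Or.inr ⟨hlr, ?_⟩
    have hl := (hlift s(k, k') hkk).2
    generalize lift s(k, k') = e at hl
    induction e with | h u v => ?_
    refine hρ s hs u v ?_
    rcases Sym2.eq_iff.1 hl with ⟨rfl, rfl⟩ | ⟨rfl, rfl⟩
    · rw [← hsecf u, ← hsecf v]; exact hne
    · rw [← hsecf u, ← hsecf v]; exact hne.symm)
  have hcardS : ((edges Γ).filter fun e => r ≤ len (pts x n) (lift e) ∨
      (len (pts x n) (lift e) < r ∧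
      s ∈ Set.Icc (ρ (lift e)) (ρ (lift e) + len (pts x n) (lift e)))).card ≤
      (((edges Γ).image lift).filter fun e => r ≤ len (pts x n) e).card +
      ((((edges Γ).image lift).filter fun e => len (pts x n) e < r).filter fun e =>
        s ∈ Set.Icc (ρ e) (ρ e + len (pts x n) e)).card := by
    refine le_trans (le_of_eq ?_) (Finset.card_union_le _ _)
    rw [Finset.filter_filter, ← Finset.filter_or, Finset.filter_image,
      Finset.card_image_of_injOn (hinj.mono (by
        exact Finset.coe_subset.2 (Finset.filter_subset _ _)))]
  refine le_trans ?_ (hmain.trans (Nat.succ_le_succ hcardS))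
  have hZ : ((((Finset.univ : Finset (thr (pts x t) r).ConnectedComponent).disjSum
      ((Finset.Ioc t n).filter fun i => r ≤ g i)).map Function.Embedding.some :
        Finset (Option Y)) : Set (Option Y)) ⊆
      Set.range (fun k => label x R q s (pts x n (sec k))) := by
    intro y hy
    rw [Finset.mem_coe, Finset.mem_map] at hy
    obtain ⟨z, hz, rfl⟩ := hy
    rcases z with c | i
    · induction c using SimpleGraph.ConnectedComponent.ind with | h v => ?_
      have hv := Nat.lt_succ_iff.1 v.2
      refine ⟨f ⟨v, by omega⟩, (hsecf _).trans ((hown v (by omega) (Or.inl hv)).trans ?_)⟩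
      simp [hq, hv]
    · rw [Finset.inr_mem_disjSum, Finset.mem_filter, Finset.mem_Ioc] at hz
      refine ⟨f ⟨i, by omega⟩, (hsecf _).trans
        ((hown i (by omega) (Or.inr ⟨hz.1.1, hz.1.2, hz.2⟩)).trans ?_)⟩
      simp [hq, hz.1.1]
  have hcard := Set.ncard_le_ncard hZ (Set.finite_range _)
  rw [Set.ncard_coe_finset, Finset.card_map, Finset.card_disjSum, Finset.card_univ] at hcard
  rwa [cc, Nat.card_eq_fintype_card]

end Packing


/-! ### Greedy lengths against a later spanning tree. -/

section Comparison

theorem injective_pts {X : Type*} {x : ℕ → X} {n t : ℕ} (hinj : Set.InjOn x (Set.Iic n)) (htn : t ≤ n) :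
    Function.Injective (pts x t) := fun i j h => Fin.ext
  (hinj (Set.mem_Iic.2 (by omega)) (Set.mem_Iic.2 (by omega)) h)

variable {X : Type*} [MetricSpace X]

/-- The greedy connection lengths after time `t`, together with the minimum spanning tree at
time `t`, exceed a later spanning tree by a bounded factor per edge only. -/
theorem sum_logExcess_add_le (x : ℕ → X) {t n : ℕ} (htn : t ≤ n)
    (hinj : Set.InjOn x (Set.Iic n)) {W : SimpleGraph (Fin (n + 1))} (hW : W.Connected)
    {U : SimpleGraph (Fin (t + 1))}
    (hU : ∀ r, (longEdges (pts x t) U r).card + 1 = cc (thr (pts x t) r)) {M : ℝ} (hM : 0 < M)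
    (g : ℕ → ℝ) (hg0 : ∀ i ∈ Finset.Ioc t n, 0 < g i)
    (hg : ∀ i, t < i → i ≤ n → ∀ j < i, g i ≤ dist (x i) (x j)) :
    ∑ e ∈ edges U, logExcess M (len (pts x t) e) + ∑ i ∈ Finset.Ioc t n, logExcess M (g i) ≤
      ∑ e ∈ edges W, logExcess M (len (pts x n) e) +
        2 * ((longEdges (pts x t) U M).card + (n - t : ℕ)) := by
  obtain ⟨E, hEW, hE, hpack⟩ := exists_packing x htn hW M g hg
  have h1 := sum_logExcess_le_add_two ((edges U).disjSum (Finset.Ioc t n)) E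
    (Sum.elim (len (pts x t)) g) (len (pts x n)) hM
    (by
      rintro (e | i) h
      · exact len_pos_of_mem (injective_pts hinj htn) (mem_edges.1 (Finset.inl_mem_disjSum.1 h))
      · exact hg0 i (Finset.inr_mem_disjSum.1 h))
    (fun e he => len_pos_of_mem (injective_pts hinj le_rfl) (mem_edges.1 (hEW he)))
    (fun r hr => by
      have h2 := hpack r (hM.trans_le hr) hr
      rw [← hU r] at h2
      have h3 : (((edges U).disjSum (Finset.Ioc t n)).filter
          fun i => r ≤ Sum.elim (len (pts x t)) g i).card =
          (longEdges (pts x t) U r).card + ((Finset.Ioc t n).filter fun i => r ≤ g i).card := by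
        rw [Finset.card_filter, Finset.sum_disjSum, longEdges, Finset.card_filter, Finset.card_filter]
        rfl
      rw [h3]
      push_cast at h2 ⊢
      linarith)
  rw [Finset.sum_disjSum, Finset.sum_add_distrib, Finset.sum_const, nsmul_eq_mul] at h1
  have h2 : ∑ e ∈ E, logExcess M (len (pts x n) e) ≤
      ∑ e ∈ edges W, logExcess M (len (pts x n) e) :=
    Finset.sum_le_sum_of_subset_of_nonneg hEW fun _ _ _ => logExcess_nonneg _ _
  have h3 : (E.card : ℝ) = (longEdges (pts x t) U M).card + (n - t : ℕ) := by
    have : E.card = (longEdges (pts x t) U M).card + (n - t) := by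
      have := hU M
      omega
    exact_mod_cast this
  rw [h3] at h1
  simp only [Sum.elim_inl, Sum.elim_inr] at h1
  linarith

end Comparison

/-! ### The greedy algorithm and its single steps. -/

section Algorithm

/-- A legal swap that replaces an edge by one that is shorter by a factor of at least `K`. -/
def Pending {V : Type*} (K : ℝ) (w : Sym2 V → ℝ) (T : SimpleGraph V) (s : Sym2 V × Sym2 V) :
    Prop :=
  s.1 ∈ T.edgeSet ∧ s.2 ∉ T.edgeSet ∧ ¬ s.2.IsDiag ∧ (swapEdge T s).IsTree ∧ K * w s.2 ≤ w s.1

/-- The new vertex is connected to its nearest neighbour, and then, if swaps are pending, one of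
them is performed that removes an edge of maximal length. -/
def IsGreedyAction {n : ℕ} (K : ℝ) (w : Sym2 (Fin (n + 2)) → ℝ) (T : SimpleGraph (Fin (n + 1)))
    (a : Action n) : Prop :=
  (∀ j : Fin (n + 1), w s(a.parent.castSucc, Fin.last (n + 1)) ≤
    w s(j.castSucc, Fin.last (n + 1))) ∧
  ((a.swaps = [] ∧ ∀ s, ¬ Pending K w (attach T a.parent) s) ∨
    ∃ s, a.swaps = [s] ∧ Pending K w (attach T a.parent) s ∧
      ∀ s', Pending K w (attach T a.parent) s' → w s'.1 ≤ w s.1)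

theorem exists_isGreedyAction {n : ℕ} (K : ℝ) (w : Sym2 (Fin (n + 2)) → ℝ)
    (T : SimpleGraph (Fin (n + 1))) : ∃ a : Action n, IsGreedyAction K w T a := by
  obtain ⟨j, hj⟩ := Finite.exists_min fun j : Fin (n + 1) => w s(j.castSucc, Fin.last (n + 1))
  by_cases h : ∃ s, Pending K w (attach T j) s
  · obtain ⟨s, hs, hmax⟩ := Set.exists_max_image {s | Pending K w (attach T j) s}
      (fun s => w s.1) (Set.toFinite _) h
    exact ⟨⟨j, [s]⟩, hj, Or.inr ⟨s, rfl, hs, hmax⟩⟩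
  · exact ⟨⟨j, []⟩, hj, Or.inl ⟨rfl, fun s hs => h ⟨s, hs⟩⟩⟩

/-- A greedy action. -/
noncomputable def greedyAction {n : ℕ} (K : ℝ) (w : Sym2 (Fin (n + 2)) → ℝ)
    (T : SimpleGraph (Fin (n + 1))) : Action n := (exists_isGreedyAction K w T).choose

/-- The lengths of the edges, computed from the matrix of distances. -/
noncomputable def matrixLen {V : Type*} (D : V → V → ℝ) : Sym2 V → ℝ :=
  -- Averaging makes the value symmetric for arbitrary matrices.
  Sym2.lift ⟨fun u v => (D u v + D v u) / 2, fun u v => by simp only [add_comm]⟩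

theorem matrixLen_dist {V X : Type*} [MetricSpace X] (p : V → X) :
    matrixLen (fun u v => dist (p u) (p v)) = len p := by
  ext e
  induction e with | h u v => ?_
  rw [len_mk, matrixLen, Sym2.lift_mk]
  simp only [dist_comm (p v) (p u)]
  ring

/-- The tree maintained by greedy actions, computed from the matrix of distances. -/
noncomputable def greedyTree (K : ℝ) :
    (n : ℕ) → (Fin (n + 1) → Fin (n + 1) → ℝ) → SimpleGraph (Fin (n + 1))
  | 0, _ => ⊥
  | n + 1, D =>
    let T := greedyTree K n fun i j => D i.castSucc j.castSucc
    let a := greedyAction K (matrixLen D) T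
    applySwaps (attach T a.parent) a.swaps

/-- The online algorithm that performs greedy actions. -/
noncomputable def greedyAlgorithm (K : ℝ) : OnlineAlgorithm where
  act n D := greedyAction K (matrixLen D) (greedyTree K n fun i j => D i.castSucc j.castSucc)

variable {X : Type*} [MetricSpace X] (K : ℝ) (x : ℕ → X)

theorem tree_greedyAlgorithm (n : ℕ) :
    (greedyAlgorithm K).tree x n = greedyTree K n fun i j => dist (x i) (x j) := by
  induction n with
  | zero => rfl
  | succ n ih =>
    rw [OnlineAlgorithm.tree, ih]
    rfl

theorem isGreedyAction (n : ℕ) :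
    IsGreedyAction K (len (pts x (n + 1))) ((greedyAlgorithm K).tree x n)
      ((greedyAlgorithm K).action x n) := by
  have h := (exists_isGreedyAction K (matrixLen fun i j : Fin (n + 2) => dist (x i) (x j))
    ((greedyAlgorithm K).tree x n)).choose_spec
  have hlen : len (pts x (n + 1)) = matrixLen fun i j : Fin (n + 2) => dist (x i) (x j) :=
    (matrixLen_dist (pts x (n + 1))).symm
  have ha : (greedyAlgorithm K).action x n = greedyAction K
      (matrixLen fun i j : Fin (n + 2) => dist (x i) (x j)) ((greedyAlgorithm K).tree x n) := by
    rw [tree_greedyAlgorithm]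
    rfl
  rw [ha, hlen]
  exact h

/-- The tree after the arrival of `x (n + 1)`, before the swap. -/
noncomputable def preTree (n : ℕ) : SimpleGraph (Fin (n + 2)) :=
  attach ((greedyAlgorithm K).tree x n) ((greedyAlgorithm K).action x n).parent

/-- The length of the edge that connects `x i` upon its arrival. -/
noncomputable def connectLen : ℕ → ℝ
  | 0 => 0
  | n + 1 => dist (x ((greedyAlgorithm K).action x n).parent) (x (n + 1))

theorem connectLen_le {i : ℕ} (hi : 0 < i) {j : ℕ} (hj : j < i) :
    connectLen K x i ≤ dist (x i) (x j) := by
  obtain ⟨n, rfl⟩ : ∃ n, i = n + 1 := ⟨i - 1, by omega⟩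
  have h := (isGreedyAction K x n).1 ⟨j, hj⟩
  rw [dist_comm]
  exact h

theorem connectLen_pos {n : ℕ} (hinj : Set.InjOn x (Set.Iic n)) {i : ℕ} (hi : 0 < i)
    (hin : i ≤ n) : 0 < connectLen K x i := by
  obtain ⟨m, rfl⟩ : ∃ m, i = m + 1 := ⟨i - 1, by omega⟩
  refine dist_pos.2 fun h => ?_
  have h2 := hinj (Set.mem_Iic.2 (by omega)) (Set.mem_Iic.2 hin) h
  have := ((greedyAlgorithm K).action x m).parent.2
  omega

theorem sum_preTree (F : ℝ → ℝ) (n : ℕ) :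
    ∑ e ∈ edges (preTree K x n), F (len (pts x (n + 1)) e) = F (connectLen K x (n + 1)) +
      ∑ e ∈ edges ((greedyAlgorithm K).tree x n), F (len (pts x n) e) := by
  rw [preTree, sum_edges_attach]
  congr 1
  refine Finset.sum_congr rfl fun e _ => ?_
  rw [len_map]
  rfl

/-- One step of the algorithm. -/
theorem step_cases (n : ℕ) :
    ((greedyAlgorithm K).numSwaps x n = 0 ∧
      (greedyAlgorithm K).tree x (n + 1) = preTree K x n ∧
      ValidSwaps (preTree K x n) ((greedyAlgorithm K).action x n).swaps ∧
      ∀ s, ¬ Pending K (len (pts x (n + 1))) (preTree K x n) s) ∨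
    ((greedyAlgorithm K).numSwaps x n = 1 ∧ ∃ s,
      (greedyAlgorithm K).tree x (n + 1) = swapEdge (preTree K x n) s ∧
      ValidSwaps (preTree K x n) ((greedyAlgorithm K).action x n).swaps ∧
      Pending K (len (pts x (n + 1))) (preTree K x n) s ∧
      ∀ s', Pending K (len (pts x (n + 1))) (preTree K x n) s' →
        len (pts x (n + 1)) s'.1 ≤ len (pts x (n + 1)) s.1) := by
  rcases (isGreedyAction K x n).2 with ⟨h, hno⟩ | ⟨s, h, hs, hmax⟩
  · left
    rw [OnlineAlgorithm.numSwaps, OnlineAlgorithm.tree, h]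
    exact ⟨rfl, rfl, trivial, hno⟩
  · right
    rw [OnlineAlgorithm.numSwaps, OnlineAlgorithm.tree, h]
    exact ⟨rfl, s, rfl, ⟨hs.1, hs.2.1, hs.2.2.2.1, trivial⟩, hs, hmax⟩

theorem isTree_tree (n : ℕ) : ((greedyAlgorithm K).tree x n).IsTree := by
  induction n with
  | zero =>
    have : Subsingleton (Fin (0 + 1)) := inferInstanceAs (Subsingleton (Fin 1))
    exact SimpleGraph.IsTree.of_subsingleton
  | succ n ih =>
    rcases step_cases K x n with ⟨-, h, -⟩ | ⟨-, s, h, -, hs, -⟩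
    · rw [h]; exact isTree_attach ih _
    · rw [h]; exact hs.2.2.2.1

theorem isTree_preTree (n : ℕ) : (preTree K x n).IsTree := isTree_attach (isTree_tree K x n) _

theorem numSwaps_le_one (n : ℕ) : (greedyAlgorithm K).numSwaps x n ≤ 1 := by
  rcases step_cases K x n with ⟨h, -⟩ | ⟨h, -⟩ <;> omega

theorem validSwaps (n : ℕ) :
    ValidSwaps (preTree K x n) ((greedyAlgorithm K).action x n).swaps := by
  rcases step_cases K x n with ⟨-, -, h, -⟩ | ⟨-, s, -, h, -⟩ <;> exact h

theorem sum_swapEdge_of_pending {V : Type*} [Finite V] {w : Sym2 V → ℝ} {T : SimpleGraph V}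
    {s : Sym2 V × Sym2 V} (h : Pending K w T s) (F : ℝ → ℝ) :
    ∑ e ∈ edges (swapEdge T s), F (w e) = ∑ e ∈ edges T, F (w e) - F (w s.1) + F (w s.2) :=
  sum_edges_swapEdge h.1 h.2.1 h.2.2.1 fun e => F (w e)

/-- If no swap that removes an edge of length at least `L` is pending, then the number of long
edges is optimal up to the factor `K` in the length. -/
theorem card_longEdges_le_of_not_pending {V : Type*} [Finite V] {p : V → X}
    (hp : Function.Injective p) {T : SimpleGraph V} (hT : T.IsTree) {L : ℝ} (hK : 1 < K)
    (h : ∀ s, Pending K (len p) T s → len p s.1 < L) {r : ℝ} (hr : L ≤ r) :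
    (longEdges p T r).card + 1 ≤ cc (thr p (r / K)) := by
  refine card_longEdges_le hT fun e he hre u v huv => ?_
  have hK0 : 0 < K := by linarith
  rw [div_le_iff₀ hK0, mul_comm]
  -- A closer pair would give a pending swap that removes `e`, unless it is `e` itself, which `K >
  -- 1` excludes.
  by_contra! hlt
  have hne : u ≠ v := fun h => huv (h ▸ SimpleGraph.Reachable.refl _)
  by_cases huvT : s(u, v) ∈ T.edgeSet
  · have huve : s(u, v) = e := by
      by_contra hne
      exact huv (SimpleGraph.Adj.reachable ((SimpleGraph.deleteEdges_adj).2 ⟨huvT, hne⟩))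
    rw [← huve, len_mk] at hre
    have := dist_pos.2 (hp.ne hne)
    nlinarith
  · have := h (e, s(u, v)) ⟨he, huvT, by simpa using hne, isTree_swapEdge hT he huv, by
      rw [len_mk]; linarith⟩
    simp only at this
    linarith

end Algorithm


/-! ### The amortized number of swaps. -/

section Amortized

variable {X : Type*} [MetricSpace X] {K : ℝ} (x : ℕ → X)

theorem card_edges_tree (n : ℕ) : (edges ((greedyAlgorithm K).tree x n)).card = n := by
  have := isTree_card_edges (isTree_tree K x n)
  rw [Nat.card_eq_fintype_card, Fintype.card_fin] at this
  omega

/-- An arrival contributes the logarithm of its connection length, and a swap lowers the sum by at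
least `log K`. -/
theorem sum_log_len_add_le (hK : 0 < K) {n : ℕ} (hinj : Set.InjOn x (Set.Iic n)) :
    ∀ m ≤ n, ∑ e ∈ edges ((greedyAlgorithm K).tree x m), Real.log (len (pts x m) e) +
      (∑ i ∈ Finset.range m, ((greedyAlgorithm K).numSwaps x i : ℝ)) * Real.log K ≤
      ∑ i ∈ Finset.Ioc 0 m, Real.log (connectLen K x i) := by
  intro m
  induction m with
  | zero =>
    intro _
    have h : edges ((greedyAlgorithm K).tree x 0) = ∅ := Finset.card_eq_zero.1
      (card_edges_tree x 0)
    simp [h]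
  | succ m ih =>
    intro hm
    have ih := ih (by omega)
    have hpre := sum_preTree K x Real.log m
    rw [Finset.sum_range_succ, Finset.sum_Ioc_succ_top (Nat.zero_le m)]
    rcases step_cases K x m with ⟨h0, h, -⟩ | ⟨h1, s, h, -, hs, -⟩
    · rw [h, hpre, h0]
      push_cast
      linarith
    · rw [h, sum_swapEdge_of_pending K hs, hpre, h1]
      have hf := len_pos (injective_pts hinj hm) hs.2.2.1
      have hlog := Real.log_le_log (mul_pos hK hf) hs.2.2.2.2
      rw [Real.log_mul hK.ne' hf.ne'] at hlog
      push_cast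
      linarith

/-- Few swaps in the amortized sense. -/
theorem sum_numSwaps_mul_log_le (hK : 0 < K) {n : ℕ} (hinj : Set.InjOn x (Set.Iic n)) :
    (∑ i ∈ Finset.range n, ((greedyAlgorithm K).numSwaps x i : ℝ)) * Real.log K ≤ 2 * n := by
  have h1 := sum_log_len_add_le x hK hinj n le_rfl
  set T := (greedyAlgorithm K).tree x n with hT
  obtain ⟨U, hU, hUr⟩ := exists_min_tree (pts x 0)
  have hpT : ∀ e ∈ edges T, 0 < len (pts x n) e := fun e he =>
    len_pos_of_mem (injective_pts hinj le_rfl) (mem_edges.1 he)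
  have hpg : ∀ i ∈ Finset.Ioc 0 n, 0 < connectLen K x i := fun i hi =>
    connectLen_pos K x hinj (Finset.mem_Ioc.1 hi).1 (Finset.mem_Ioc.1 hi).2
  -- With `M` below all lengths nothing is truncated in `logExcess`; both sums have `n` terms, so
  -- `log M` cancels.
  obtain ⟨M, hM, hMT, hMg⟩ : ∃ M, 0 < M ∧ (∀ e ∈ edges T, M ≤ len (pts x n) e) ∧
      ∀ i ∈ Finset.Ioc 0 n, M ≤ connectLen K x i := by
    classical
    set A : Finset ℝ := insert 1 ((edges T).image (len (pts x n)) ∪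
      (Finset.Ioc 0 n).image (connectLen K x)) with hA
    have hAne : A.Nonempty := ⟨1, Finset.mem_insert_self _ _⟩
    refine ⟨A.min' hAne, ?_, fun e he => A.min'_le _ ?_, fun i hi => A.min'_le _ ?_⟩
    · rw [Finset.lt_min'_iff]
      intro y hy
      rw [hA, Finset.mem_insert, Finset.mem_union, Finset.mem_image, Finset.mem_image] at hy
      rcases hy with rfl | ⟨e, he, rfl⟩ | ⟨i, hi, rfl⟩
      · exact one_pos
      · exact hpT e he
      · exact hpg i hi
    · exact Finset.mem_insert_of_mem (Finset.mem_union_left _ (Finset.mem_image_of_mem _ he))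
    · exact Finset.mem_insert_of_mem (Finset.mem_union_right _ (Finset.mem_image_of_mem _ hi))
  have h2 := sum_logExcess_add_le x (Nat.zero_le n) hinj (isTree_tree K x n).connected hUr hM
    (connectLen K x) hpg (fun i hi _ j hj => connectLen_le K x hi hj)
  rw [← hT] at h2
  have hU0 : (edges U).card = 0 := by
    have := isTree_card_edges hU
    rw [Nat.card_eq_fintype_card, Fintype.card_fin] at this
    omega
  rw [longEdges, Finset.card_eq_zero.1 hU0] at h2
  have hex : ∀ a, M ≤ a → logExcess M a = Real.log a - Real.log M := fun a ha =>
    max_eq_left (sub_nonneg.2 (Real.log_le_log hM ha))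
  rw [Finset.sum_congr rfl fun e he => hex _ (hMT e he),
    Finset.sum_congr rfl fun i hi => hex _ (hMg i hi), Finset.sum_sub_distrib,
    Finset.sum_sub_distrib, Finset.sum_const, Finset.sum_const, hT, card_edges_tree,
    Nat.card_Ioc] at h2
  simp only [Finset.sum_empty, Finset.filter_empty, Finset.card_empty, Nat.sub_zero,
    Nat.cast_zero, zero_add] at h2
  linarith

end Amortized

/-! ### Counting the edges above a given level. -/

section Levels

variable {X : Type*} [MetricSpace X]

/-- After the arrival of `x t` and before the swap, no pending swap removes an edge of length at
least `L`. -/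
def Calm (K : ℝ) (x : ℕ → X) (L : ℝ) : ℕ → Prop
  | 0 => True
  | t + 1 => ∀ s, Pending K (len (pts x (t + 1))) (preTree K x t) s → len (pts x (t + 1)) s.1 < L

theorem Calm.mono {K : ℝ} {x : ℕ → X} {L L' : ℝ} (h : L ≤ L') {t : ℕ} (ht : Calm K x L t) :
    Calm K x L' t := by
  cases t with
  | zero => trivial
  | succ t => exact fun s hs => (ht s hs).trans_le h

open Classical in
/-- The last calm time up to `n`. -/
noncomputable def lastCalm (K : ℝ) (x : ℕ → X) (n : ℕ) (L : ℝ) : ℕ :=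
  Nat.findGreatest (Calm K x L) n

theorem lastCalm_le (K : ℝ) (x : ℕ → X) (n : ℕ) (L : ℝ) : lastCalm K x n L ≤ n := by
  classical
  exact Nat.findGreatest_le n

theorem lastCalm_mono (K : ℝ) (x : ℕ → X) (n : ℕ) {L L' : ℝ} (h : L ≤ L') :
    lastCalm K x n L ≤ lastCalm K x n L' := by
  classical
  exact Nat.findGreatest_mono_left (fun t => Calm.mono h) n

theorem calm_lastCalm (K : ℝ) (x : ℕ → X) (n : ℕ) (L : ℝ) : Calm K x L (lastCalm K x n L) := by
  classical
  unfold lastCalm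
  exact Nat.findGreatest_spec (P := Calm K x L) (Nat.zero_le n) trivial

theorem not_calm (K : ℝ) (x : ℕ → X) (n : ℕ) (L : ℝ) {t : ℕ} (h : lastCalm K x n L < t)
    (htn : t ≤ n) : ¬ Calm K x L t := by
  classical
  unfold lastCalm at h
  exact Nat.findGreatest_is_greatest h htn

/-- The potential of an edge of length `a` at level `L`. -/
noncomputable def potential (K L a : ℝ) : ℝ := (if L ≤ a then Real.log K else 0) + logExcess L a

variable {K L : ℝ}

theorem logExcess_of_le (hL : 0 < L) {a : ℝ} (h : L ≤ a) :
    logExcess L a = Real.log a - Real.log L :=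
  max_eq_left (sub_nonneg.2 (Real.log_le_log hL h))

theorem logExcess_of_lt {a : ℝ} (ha : 0 < a) (h : a < L) : logExcess L a = 0 :=
  max_eq_right (sub_nonpos.2 (Real.log_le_log ha h.le))

theorem potential_mono (hK : 1 < K) {a b : ℝ} (ha : 0 < a) (hab : a ≤ b) :
    potential K L a ≤ potential K L b := by
  have hlog := Real.log_pos hK
  unfold potential
  refine add_le_add ?_ (max_le_max (sub_le_sub_right (Real.log_le_log ha hab) _) le_rfl)
  split_ifs with h1 h2
  · exact le_rfl
  · exact (h2 (h1.trans hab)).elim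
  · exact hlog.le
  · exact le_rfl

/-- If `a` falls below `L`, then `logExcess` alone may drop by less than `log K`; the jump of
`potential` at `L` makes up for this. -/
theorem potential_add_log_le (hK : 1 < K) (hL : 0 < L) {a b : ℝ} (ha : 0 < a)
    (hab : K * a ≤ b) (hb : L ≤ b) : potential K L a + Real.log K ≤ potential K L b := by
  have hlog := Real.log_pos hK
  have h2 := Real.log_le_log (mul_pos (by linarith) ha) hab
  rw [Real.log_mul (by linarith) ha.ne'] at h2
  rw [potential, potential, if_pos hb, logExcess_of_le hL hb]
  by_cases h : L ≤ a
  · rw [if_pos h, logExcess_of_le hL h]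
    linarith
  · rw [if_neg h, logExcess_of_lt ha (not_le.1 h)]
    have := Real.log_le_log hL hb
    linarith

theorem potential_le_logExcess_div (hK : 1 < K) (hL : 0 < L) {a : ℝ} (ha : 0 < a) :
    potential K L a ≤ logExcess (L / K) a := by
  rw [potential]
  split_ifs with h
  · rw [logExcess_of_le hL h, logExcess, Real.log_div hL.ne' (by linarith)]
    exact le_max_of_le_left (by linarith)
  · rw [logExcess_of_lt ha (not_le.1 h), add_zero]
    exact logExcess_nonneg _ _

theorem logExcess_div_le (hK : 1 < K) (hL : 0 < L) {a : ℝ} (ha : 0 < a) :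
    logExcess (L / K) a ≤ logExcess L a + if L / K ≤ a then Real.log K else 0 := by
  have hLK : 0 < L / K := div_pos hL (by linarith)
  split_ifs with h
  · rw [logExcess_of_le hLK h, Real.log_div hL.ne' (by linarith)]
    have : Real.log a - Real.log L ≤ logExcess L a := le_max_left _ _
    linarith
  · rw [logExcess_of_lt ha (not_le.1 h), add_zero]
    exact logExcess_nonneg _ _

theorem sum_ite_longEdges {V : Type*} [Finite V] (p : V → X) (T : SimpleGraph V) (r c : ℝ) :
    ∑ e ∈ edges T, (if r ≤ len p e then c else 0) = (longEdges p T r).card * c := by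
  rw [← Finset.sum_filter, Finset.sum_const, nsmul_eq_mul]
  rfl

theorem card_longEdges_eq_sum {V : Type*} [Finite V] (p : V → X) (T : SimpleGraph V) (r : ℝ) :
    ((longEdges p T r).card : ℝ) = ∑ e ∈ edges T, (if r ≤ len p e then 1 else 0) := by
  rw [sum_ite_longEdges, mul_one]

variable (x : ℕ → X)

/-- The state of the tree at a calm time. -/
theorem exists_tree_of_calm (hK : 1 < K) {n : ℕ}
    (hinj : Set.InjOn x (Set.Iic n)) {t : ℕ} (htn : t ≤ n) (ht : Calm K x L t) :
    ∃ T' : SimpleGraph (Fin (t + 1)),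
      (∀ r, L ≤ r → (longEdges (pts x t) T' r).card + 1 ≤ cc (thr (pts x t) (r / K))) ∧
      ((longEdges (pts x t) ((greedyAlgorithm K).tree x t) L).card : ℝ) ≤
        (longEdges (pts x t) T' L).card ∧
      ∑ e ∈ edges ((greedyAlgorithm K).tree x t), potential K L (len (pts x t) e) ≤
        ∑ e ∈ edges T', potential K L (len (pts x t) e) := by
  cases t with
  | zero =>
    refine ⟨_, fun r _ => ?_, le_rfl, le_rfl⟩
    have h : edges ((greedyAlgorithm K).tree x 0) = ∅ := Finset.card_eq_zero.1
      (card_edges_tree x 0)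
    have h0 : (longEdges (pts x 0) ((greedyAlgorithm K).tree x 0) r).card = 0 := by
      rw [longEdges, h, Finset.filter_empty, Finset.card_empty]
    have := one_le_cc (thr (pts x 0) (r / K))
    omega
  | succ t =>
    have hp := injective_pts hinj htn
    -- Calmness concerns the tree before the swap; the swap itself only shortens an edge, so it
    -- raises neither count nor potential.
    refine ⟨preTree K x t, fun r hr =>
      card_longEdges_le_of_not_pending K hp (isTree_preTree K x t) hK ht hr, ?_⟩
    rcases step_cases K x t with ⟨-, h, -⟩ | ⟨-, s, h, -, hs, -⟩
    · rw [h]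
      exact ⟨le_rfl, le_rfl⟩
    · have hf := len_pos hp hs.2.2.1
      have hle : len (pts x (t + 1)) s.2 ≤ len (pts x (t + 1)) s.1 := by
        have := hs.2.2.2.2
        nlinarith
      rw [h, card_longEdges_eq_sum, card_longEdges_eq_sum,
        sum_swapEdge_of_pending K hs (fun a => if L ≤ a then (1 : ℝ) else 0),
        sum_swapEdge_of_pending K hs]
      constructor
      · have : (if L ≤ len (pts x (t + 1)) s.2 then (1 : ℝ) else 0) ≤
            if L ≤ len (pts x (t + 1)) s.1 then 1 else 0 := by
          split_ifs with h1 h2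
          · exact le_rfl
          · exact (h2 (h1.trans hle)).elim
          · exact zero_le_one
          · exact le_rfl
        linarith
      · have := potential_mono (L := L) hK hf hle
        linarith

/-- The effect of the steps without calm. -/
theorem step_of_not_calm (hK : 1 < K) (hL : 0 < L) {n : ℕ} (hinj : Set.InjOn x (Set.Iic n))
    {t : ℕ} (htn : t < n) (ht : ¬ Calm K x L (t + 1)) :
    ((longEdges (pts x (t + 1)) ((greedyAlgorithm K).tree x (t + 1)) L).card : ℝ) ≤
        (longEdges (pts x t) ((greedyAlgorithm K).tree x t) L).card + 1 ∧
      ∑ e ∈ edges ((greedyAlgorithm K).tree x (t + 1)), potential K L (len (pts x (t + 1)) e) +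
        Real.log K ≤
        ∑ e ∈ edges ((greedyAlgorithm K).tree x t), potential K L (len (pts x t) e) +
          potential K L (connectLen K x (t + 1)) := by
  obtain ⟨s₀, hs₀, hL₀⟩ : ∃ s, Pending K (len (pts x (t + 1))) (preTree K x t) s ∧
      L ≤ len (pts x (t + 1)) s.1 := by
    rw [Calm] at ht
    push Not at ht
    exact ht
  rcases step_cases K x t with ⟨-, -, -, h⟩ | ⟨-, s, h, -, hs, hmax⟩
  · exact (h s₀ hs₀).elim
  -- The performed swap removes an edge of maximal length among the pending ones, hence one of
  -- length at least `L`.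
  have hLs := hL₀.trans (hmax s₀ hs₀)
  have hf := len_pos (injective_pts hinj htn) hs.2.2.1
  rw [h, card_longEdges_eq_sum, card_longEdges_eq_sum,
    sum_swapEdge_of_pending K hs (fun a => if L ≤ a then (1 : ℝ) else 0),
    sum_swapEdge_of_pending K hs, sum_preTree K x (potential K L),
    sum_preTree K x (fun a => if L ≤ a then (1 : ℝ) else 0), if_pos hLs]
  constructor
  -- The connection adds at most one long edge; the swap removes one and adds at most one.
  · have h1 : ∀ a : ℝ, (if L ≤ a then (1 : ℝ) else 0) ≤ 1 := fun a => by split_ifs <;> norm_num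
    have h2 := h1 (len (pts x (t + 1)) s.2)
    have h3 := h1 (connectLen K x (t + 1))
    linarith
  · have := potential_add_log_le hK hL hf hs.2.2.2.2 hLs
    linarith

theorem sum_potential_add_le (hK : 1 < K) (hL : 0 < L) {n : ℕ}
    (hinj : Set.InjOn x (Set.Iic n)) {t : ℕ} (ht : ∀ m, t < m → m ≤ n → ¬ Calm K x L m) :
    ∀ k, t + k ≤ n →
      ((longEdges (pts x (t + k)) ((greedyAlgorithm K).tree x (t + k)) L).card : ℝ) ≤
        (longEdges (pts x t) ((greedyAlgorithm K).tree x t) L).card + k ∧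
      ∑ e ∈ edges ((greedyAlgorithm K).tree x (t + k)), potential K L (len (pts x (t + k)) e) +
        k * Real.log K ≤
        ∑ e ∈ edges ((greedyAlgorithm K).tree x t), potential K L (len (pts x t) e) +
          ∑ i ∈ Finset.Ioc t (t + k), potential K L (connectLen K x i) := by
  intro k
  induction k with
  | zero => intro _; simp
  | succ k ih =>
    intro hk
    obtain ⟨h1, h2⟩ := ih (by omega)
    obtain ⟨h3, h4⟩ := step_of_not_calm x hK hL hinj (t := t + k) (by omega)
      (ht _ (by omega) (by omega))
    rw [← add_assoc, Finset.sum_Ioc_succ_top (by omega)]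
    push_cast
    constructor <;> linarith

/-- The number of long edges at any time, against the numbers of components at the last calm time
and at the present time. -/
theorem card_longEdges_tree_le (hK : 4 ≤ Real.log K) (hK1 : 1 < K) (hL : 0 < L) {n : ℕ}
    (hinj : Set.InjOn x (Set.Iic n)) :
    ((longEdges (pts x n) ((greedyAlgorithm K).tree x n) L).card : ℝ) ≤
      4 * ((cc (thr (pts x (lastCalm K x n L)) (L / K)) : ℝ) - 1) +
        2 * ((cc (thr (pts x n) (L / K)) : ℝ) - 1) := by
  have hLK : 0 < L / K := div_pos hL (by linarith)
  set t := lastCalm K x n L with ht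
  have htn : t ≤ n := lastCalm_le K x n L
  obtain ⟨k, hk⟩ : ∃ k, n = t + k := ⟨n - t, by omega⟩
  obtain ⟨T', hT'c, hT'L, hT'p⟩ := exists_tree_of_calm x hK1 hinj htn
    (calm_lastCalm K x n L)
  obtain ⟨U, hU, hUr⟩ := exists_min_tree (pts x t)
  obtain ⟨W, hW, hWr⟩ := exists_min_tree (pts x n)
  obtain ⟨h1, h2⟩ := sum_potential_add_le x hK1 hL hinj
    (fun m => not_calm K x n L) k hk.ge
  rw [← ht, ← hk] at h1 h2
  have hpn := injective_pts hinj le_rfl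
  have hpt := injective_pts hinj htn
  have hposn : ∀ {T : SimpleGraph (Fin (n + 1))}, ∀ e ∈ edges T, 0 < len (pts x n) e :=
    fun e he => len_pos_of_mem hpn (mem_edges.1 he)
  have hpost : ∀ {T : SimpleGraph (Fin (t + 1))}, ∀ e ∈ edges T, 0 < len (pts x t) e :=
    fun e he => len_pos_of_mem hpt (mem_edges.1 he)
  have hgpos : ∀ i ∈ Finset.Ioc t n, 0 < connectLen K x i := fun i hi =>
    connectLen_pos K x hinj (by have := Finset.mem_Ioc.1 hi; omega) (Finset.mem_Ioc.1 hi).2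
  have hrel := sum_logExcess_add_le x htn hinj hW.connected hUr hLK (connectLen K x) hgpos
    (fun i hi _ j hj => connectLen_le K x (by omega) hj)
  have hg : ∑ i ∈ Finset.Ioc t n, potential K L (connectLen K x i) ≤
      ∑ i ∈ Finset.Ioc t n, logExcess (L / K) (connectLen K x i) :=
    Finset.sum_le_sum fun i hi => potential_le_logExcess_div hK1 hL (hgpos i hi)
  have hT'sum : ∑ e ∈ edges T', potential K L (len (pts x t) e) =
      (longEdges (pts x t) T' L).card * Real.log K +
        ∑ e ∈ edges T', logExcess L (len (pts x t) e) := by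
    rw [← sum_ite_longEdges, ← Finset.sum_add_distrib]
    rfl
  have hT'U : ∑ e ∈ edges T', logExcess L (len (pts x t) e) ≤
      ∑ e ∈ edges U, logExcess (L / K) (len (pts x t) e) :=
    sum_logExcess_le _ _ _ _ hL (by linarith) hpost hpost fun r hr => by
      have h3 := hT'c r hr
      rw [← hUr] at h3
      exact Nat.succ_le_succ_iff.1 h3
  have hTn : ∑ e ∈ edges W, logExcess L (len (pts x n) e) ≤
      ∑ e ∈ edges ((greedyAlgorithm K).tree x n), potential K L (len (pts x n) e) := by
    have h3 := sum_logExcess_le (edges W) (edges ((greedyAlgorithm K).tree x n))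
      (len (pts x n)) (len (pts x n)) hL one_pos hposn hposn fun r hr => by
        have h4 := cc_thr_le (isTree_tree K x n).connected (pts x n) r
        rw [← hWr] at h4
        rw [div_one]
        exact Nat.succ_le_succ_iff.1 h4
    rw [div_one] at h3
    refine h3.trans (Finset.sum_le_sum fun e _ => ?_)
    rw [potential]
    split_ifs <;> linarith
  have hWdiv : ∑ e ∈ edges W, logExcess (L / K) (len (pts x n) e) ≤
      ∑ e ∈ edges W, logExcess L (len (pts x n) e) +
        (longEdges (pts x n) W (L / K)).card * Real.log K := by
    rw [← sum_ite_longEdges, ← Finset.sum_add_distrib]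
    exact Finset.sum_le_sum fun e he => logExcess_div_le hK1 hL (hposn e he)
  have hT'A : ((longEdges (pts x t) T' L).card : ℝ) ≤ (longEdges (pts x t) U (L / K)).card := by
    have h3 := hT'c L le_rfl
    rw [← hUr] at h3
    exact_mod_cast Nat.succ_le_succ_iff.1 h3
  rw [← hUr, ← hWr]
  push_cast
  set A : ℝ := ((longEdges (pts x t) U (L / K)).card : ℝ)
  set N : ℝ := ((longEdges (pts x n) W (L / K)).card : ℝ)
  have hnt : ((n - t : ℕ) : ℝ) = k := by
    rw [hk, Nat.add_sub_cancel_left]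
  rw [hnt] at hrel
  have hA0 : 0 ≤ A := Nat.cast_nonneg _
  have hk0 : (0 : ℝ) ≤ k := Nat.cast_nonneg _
  -- All sums of `logExcess` cancel along the chain from the tree at time `t` through `U` and `W` to
  -- the tree at time `n`. Lowering the threshold from `L` to `L / K` costs `N * log K` on `W`, and
  -- the packing costs `2 * (A + k)`.
  have hmain : k * Real.log K ≤ (A + N) * Real.log K + 2 * (A + k) := by
    have := mul_le_mul_of_nonneg_right hT'A (by linarith : (0 : ℝ) ≤ Real.log K)
    linarith
  -- For `log K ≥ 4` the ratios `(log K + 2) / (log K - 2)` and `log K / (log K - 2)` are at most 3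
  -- and 2.
  have hkAN : (k : ℝ) ≤ 3 * A + 2 * N := by
    by_contra! hlt
    nlinarith
  linarith

end Levels

/-! ### Integration over all levels. -/

section Cost

variable {X : Type*} [MetricSpace X] {K : ℝ} (x : ℕ → X)

theorem cost_tree_le (hK : 4 ≤ Real.log K) (hK1 : 1 < K) {n : ℕ}
    (hinj : Set.InjOn x (Set.Iic n)) {V : Type*} [Fintype V] (p : V → X)
    (hp : ∀ i ≤ n, ∃ v, p v = x i) {G : SimpleGraph V} (hG : G.Connected) :
    cost (pts x n) ((greedyAlgorithm K).tree x n) ≤ 18 * K * cost p G := by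
  have hK0 : 0 < K := by linarith
  -- The level `L = 3 * K * s` turns the threshold `L / K` into the `3 * s` of the moats. The
  -- weights 4 and 2 below are those of `card_longEdges_tree_le`; together they charge each Steiner
  -- edge 6 times its length.
  obtain ⟨ρ, hρ⟩ := exists_moats x n p hp hG (fun s => lastCalm K x n (3 * K * s))
    (fun s => lastCalm_le _ _ _ _) (fun s s' _ hss => lastCalm_mono _ _ _ (by gcongr))
  obtain ⟨ρ', hρ'⟩ := exists_moats x n p hp hG (fun _ => n) (fun _ => le_rfl)
    (fun _ _ _ _ => le_rfl)
  have h := sum_le_of_card_le (edges ((greedyAlgorithm K).tree x n)) (edges G) 0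
    (fun e => len (pts x n) e / (3 * K))
    (fun e => (Set.Icc (ρ e) (ρ e + len p e)).indicator (fun _ => 4) +
      (Set.Icc (ρ' e) (ρ' e + len p e)).indicator (fun _ => 2))
    (fun e => 6 * len p e)
    (fun _ _ => (measurable_const.indicator measurableSet_Icc).add
      (measurable_const.indicator measurableSet_Icc))
    (fun e _ => mul_nonneg (by norm_num) (len_nonneg p e))
    (fun e _ => by
      simp only [Pi.add_apply]
      rw [lintegral_add_left (measurable_const.indicator measurableSet_Icc),
        lintegral_indicator_const measurableSet_Icc, lintegral_indicator_const measurableSet_Icc,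
        Real.volume_Icc, Real.volume_Icc, add_sub_cancel_left, add_sub_cancel_left,
        ← add_mul, ENNReal.ofReal_mul (by norm_num)]
      refine mul_le_mul_left (le_of_eq ?_) _
      norm_num)
    (fun s hs => by
      have h1 := card_longEdges_tree_le x hK hK1 (L := 3 * K * s) (by positivity) hinj
      rw [show 3 * K * s / K = 3 * s by field_simp] at h1
      have h2 : ((cc (thr (pts x (lastCalm K x n (3 * K * s))) (3 * s)) : ℕ) : ℝ) ≤ _ :=
        Nat.cast_le.2 (hρ s hs)
      have h3 : ((cc (thr (pts x n) (3 * s)) : ℕ) : ℝ) ≤ _ := Nat.cast_le.2 (hρ' s hs)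
      push_cast at h2 h3
      have h4 : ((edges ((greedyAlgorithm K).tree x n)).filter
          fun e => s < len (pts x n) e / (3 * K)).card ≤
          (longEdges (pts x n) ((greedyAlgorithm K).tree x n) (3 * K * s)).card := by
        refine Finset.card_le_card fun e he => ?_
        rw [Finset.mem_filter, lt_div_iff₀ (by positivity)] at he
        exact Finset.mem_filter.2 ⟨he.1, by linarith [he.2]⟩
      have h5 : ((edges ((greedyAlgorithm K).tree x n)).filter
          fun e => s < len (pts x n) e / (3 * K)).card ≤
          ((edges G).filter fun e => s ∈ Set.Icc (ρ e) (ρ e + len p e)).card * 4 +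
          ((edges G).filter fun e => s ∈ Set.Icc (ρ' e) (ρ' e + len p e)).card * 2 := by
        have h4' := (Nat.cast_le (α := ℝ)).2 h4
        rw [← Nat.cast_le (α := ℝ)]
        push_cast
        linarith
      refine (Nat.cast_le.2 h5).trans (le_of_eq ?_)
      rw [Nat.cast_add, Nat.cast_mul, Nat.cast_mul, Finset.natCast_card_filter,
        Finset.natCast_card_filter, Finset.sum_mul, Finset.sum_mul, ← Finset.sum_add_distrib]
      refine Finset.sum_congr rfl fun e _ => ?_
      rw [Pi.add_apply, Set.indicator_apply, Set.indicator_apply]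
      simp only [ite_mul, one_mul, zero_mul, Nat.cast_ofNat])
  rw [cost_eq, cost_eq]
  rw [← Finset.mul_sum] at h
  have h2 : ∑ e ∈ edges ((greedyAlgorithm K).tree x n), max (len (pts x n) e / (3 * K) - 0) 0 =
      (∑ e ∈ edges ((greedyAlgorithm K).tree x n), len (pts x n) e) / (3 * K) := by
    rw [Finset.sum_div]
    refine Finset.sum_congr rfl fun e _ => ?_
    rw [sub_zero, max_eq_left (div_nonneg (len_nonneg _ _) (by positivity))]
  rw [h2, div_le_iff₀ (by positivity)] at h
  linarith

/-- The bound from below on the infimum needs a nonempty set, since `sInf ∅ = 0` in the reals. -/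
theorem exists_steiner_tree (x : ℕ → X) (n : ℕ) :
    {c : ℝ | ∃ (V : Finset X) (G : SimpleGraph V),
      (∀ i ≤ n, x i ∈ V) ∧ G.IsTree ∧ c = cost (fun v : V => (v : X)) G}.Nonempty := by
  classical
  let V : Finset X := (Finset.range (n + 1)).image x
  have hV : ∀ i ≤ n, x i ∈ V := fun i hi => Finset.mem_image_of_mem _ (Finset.mem_range.2 (by omega))
  have : Nonempty V := ⟨⟨x 0, hV 0 (Nat.zero_le n)⟩⟩
  obtain ⟨G, -, hG⟩ := (SimpleGraph.connected_top (V := V)).exists_isTree_le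
  exact ⟨_, V, G, hV, hG, rfl⟩

theorem cost_tree_le_steinerOpt (hK : 4 ≤ Real.log K) (hK1 : 1 < K) {n : ℕ}
    (hinj : Set.InjOn x (Set.Iic n)) :
    cost (pts x n) ((greedyAlgorithm K).tree x n) ≤ 18 * K * steinerOpt x n := by
  have hK0 : 0 < 18 * K := by linarith
  rw [← div_le_iff₀' hK0]
  refine le_csInf (exists_steiner_tree x n) ?_
  rintro _ ⟨V, G, hV, hG, rfl⟩
  rw [div_le_iff₀' hK0]
  exact cost_tree_le x hK hK1 hinj _ (fun i hi => ⟨⟨x i, hV i hi⟩, rfl⟩) hG.connected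

end Cost

end OnlineSteiner

/-! ### Choice of the constants. -/

theorem mainTheorem4 :
    ∃ c : ℝ, 0 < c ∧ ∀ δ : ℝ, 0 < δ → δ ≤ 1 →
      ∃ A : OnlineSteiner.OnlineAlgorithm,
        ∀ (X : Type*) [MetricSpace X] (x : ℕ → X) (n : ℕ), Set.InjOn x (Set.Iic n) →
          (A.tree x n).IsTree ∧
          OnlineSteiner.cost (fun i : Fin (n + 1) => x i) (A.tree x n)
            ≤ (2 : ℝ) ^ (c / δ) * OnlineSteiner.steinerOpt x n ∧
          (∀ i < n,
            OnlineSteiner.ValidSwaps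
              (OnlineSteiner.attach (A.tree x i) (A.action x i).parent) (A.action x i).swaps ∧
            A.numSwaps x i ≤ 1) ∧
          (∑ i ∈ Finset.range n, (A.numSwaps x i : ℝ)) ≤ δ * n := by
  -- The factor `18 * K` is absorbed by `K ^ 2 = 2 ^ (12 / δ)`, as `K ≥ 64`; moreover `δ * log K = 6
  -- * log 2 ≥ 4`.
  refine ⟨12, by norm_num, fun δ hδ hδ1 => ?_⟩
  set K : ℝ := 2 ^ (6 / δ) with hKdef
  have hK64 : 64 ≤ K := by
    have h : (2 : ℝ) ^ (6 : ℝ) ≤ 2 ^ (6 / δ) := Real.rpow_le_rpow_of_exponent_le one_le_two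
      ((le_div_iff₀ hδ).2 (by linarith))
    refine le_trans (le_of_eq ?_) h
    norm_num
  have hlogδ : 4 ≤ δ * Real.log K := by
    rw [hKdef, Real.log_rpow two_pos, ← mul_assoc, mul_div_cancel₀ _ hδ.ne']
    linarith [Real.log_two_gt_d9]
  have hlog0 : 0 ≤ Real.log K := Real.log_nonneg (by linarith)
  have hlog : 4 ≤ Real.log K := hlogδ.trans (mul_le_of_le_one_left hlog0 hδ1)
  refine ⟨OnlineSteiner.greedyAlgorithm K, fun X _ x n hinj =>
    ⟨OnlineSteiner.isTree_tree K x n, ?_, fun i _ =>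
      ⟨OnlineSteiner.validSwaps K x i, OnlineSteiner.numSwaps_le_one K x i⟩, ?_⟩⟩
  · have h := OnlineSteiner.cost_tree_le_steinerOpt x hlog (by linarith) hinj
    refine h.trans (mul_le_mul_of_nonneg_right ?_ ?_)
    · rw [show (12 : ℝ) / δ = 6 / δ + 6 / δ by ring, Real.rpow_add two_pos, ← hKdef]
      nlinarith
    · refine Real.sInf_nonneg ?_
      rintro _ ⟨V, G, -, -, rfl⟩
      rw [OnlineSteiner.cost_eq]
      exact Finset.sum_nonneg fun e _ => OnlineSteiner.len_nonneg _ e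
  · have h := OnlineSteiner.sum_numSwaps_mul_log_le x (by linarith : 0 < K) hinj
    set S : ℝ := ∑ i ∈ Finset.range n, ((OnlineSteiner.greedyAlgorithm K).numSwaps x i : ℝ)
    have hn : (0 : ℝ) ≤ n := Nat.cast_nonneg n
    -- More than `δ * n` swaps would give `4 * n ≤ 2 * n`, so `n = 0`; then the positive sum `S`
    -- contradicts `S * log K ≤ 0`.
    by_contra! hlt
    have h1 : δ * n * Real.log K ≤ S * Real.log K := mul_le_mul_of_nonneg_right hlt.le hlog0
    have hS : 0 ≤ S := Finset.sum_nonneg fun _ _ => Nat.cast_nonneg _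
    have hn0 : (n : ℝ) = 0 := by nlinarith
    have hS0 : S * Real.log K ≤ 0 := by rw [hn0] at h; linarith
    have : 0 < S := by rw [hn0] at hlt; linarith
    nlinarith
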